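/- **Setting.** Let $G$ be a finite $D$-regular simple graph, $D\ge 1$, on a nonempty vertex set $V$ with $n=|V|$, identified with its random-walk matrix $W$ ($W_{uv}=1/D$ if $u,v$ are adjacent, $0$ otherwise). For nonempty $S\subseteq V$ the *measure* of $S$ is $|S|/n$, and the *expansion* of $S$ is $\Pr[y\notin S]$, where $x$ is uniform in $S$ and $y$ is a uniformly random neighbour of $x$. For $\lambda\in\mathbb R$ let $V_{\ge\lambda}\subseteq\mathbb R^V$ be the span of the eigenfunctions of $W$ with eigenvalue at least $\lambda$, and $\Pi_{\ge\lambda}$ the orthogonal projector onto it. A *level-$\ell$ pseudo-expectation* in a finite set of real variables is a linear functional $\tilde{\mathbb E}$ on polynomials of degree at most $\ell$ with $\tilde{\mathbb E}\,1=1$ and $\tilde{\mathbb E}\,P^2\ge 0$ whenever $\deg P\le \ell/2$. It is *consistent* with $P\equiv 0$ (where $\deg P\le \ell/2$) if $\tilde{\mathbb E}\,P^2=0$, and with $Q\ge 0$ if it is consistent with $Q-y^2\equiv 0$, where $y$ is an additional variable belonging to that inequality. The level-$\ell$ sum-of-squares relaxation of a system of polynomial equations and inequalities is *feasible* if some level-$\ell$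 pseudo-expectation is consistent with all of them simultaneously. For $\lambda\in\mathbb R$, $\varepsilon,c>0$ and an integer $k\ge 1$ let $\mathcal S_k(G;\lambda,\varepsilon,c)$ be the following system in the variables $f(u),g(u)$ ($u\in V$): $$f(u)^2=f(u)\ \ (u\in V),\qquad \sum_{u}f(u)=k,\qquad \sum_{u,v}W_{uv}f(u)(1-f(v))\le\varepsilon k,$$ $$\pm\,c\,g(u)\le\big((\Pi_{\ge\lambda}f)(u)\big)^2\ \ (u\in V),\qquad \frac1n\sum_u\big((\Pi_{\ge\lambda}g)(u)\big)^4\ge c\,\frac kn .$$ **Theorem.** There are absolute constants $C\ge 1$, $\ell\in\mathbb N$ and $c,\mu_0,\varepsilon_0>0$ such that for all $0<\mu<\mu_0$ and $0<\varepsilon<\varepsilon_0$, with $\lambda=1-C\varepsilon$, the following test, which uses only sum-of-squares relaxations of the constant level $\ell$, solves the promise problem below on regular graphs $G$. Test: accept if and only if for some integer $k\ge 1$ with $k/n\le\mu/(\dim V_{\ge\lambda})^{1/3}$ the level-$\ell$ relaxation of $\mathcal S_k(G;\lambda,\varepsilon,c)$ is feasible. * **Yes:** if $G$ contains a nonempty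 vertex set of measure at most $\mu/(\dim V_{\ge\lambda})^{1/3}$ and expansion at most $\varepsilon$, then the test accepts. * **No:** if all nonempty vertex sets of measure at most $C\sqrt\mu$ have expansion at least $1-1/C$, then the test does not accept. -/

import Mathlib

open Finset

namespace SSE

noncomputable section

/-! ### Graphs: random walk, measure, expansion, top eigenspace -/

section Graph

variable {V : Type*} [Fintype V] [DecidableEq V]

/-- The measure `|S| / |V|` of a vertex set. -/
def setMeasure (S : Finset V) : ℝ := (S.card : ℝ) / (Fintype.card V : ℝ)

/-- The expansion of a (nonempty) vertex set `S`: the probability that `y ∉ S`, where `x` is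
uniform in `S` and `y` is a uniformly random neighbour of `x`. -/
def expansion (G : SimpleGraph V) [DecidableRel G.Adj] (S : Finset V) : ℝ :=
  (∑ x ∈ S, ((G.neighborFinset x \ S).card : ℝ) / (G.degree x : ℝ)) / (S.card : ℝ)

/-- The random-walk matrix (normalized adjacency matrix) of `G`. -/
def walkMatrix (G : SimpleGraph V) [DecidableRel G.Adj] : Matrix V V ℝ :=
  Matrix.of fun u v => if G.Adj u v then 1 / (G.degree u : ℝ) else 0

/-- `V_{≥ lam}`: the span of the eigenfunctions of the random-walk matrix with eigenvalue at
least `lam`. -/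
def topEigenspace (G : SimpleGraph V) [DecidableRel G.Adj] (lam : ℝ) :
    Submodule ℝ (EuclideanSpace ℝ V) :=
  ⨆ η ∈ Set.Ici lam, Module.End.eigenspace (Matrix.toEuclideanLin (walkMatrix G)) η

/-- `(dim V_{≥ lam})^{1/3}`. -/
def dimFactor (G : SimpleGraph V) [DecidableRel G.Adj] (lam : ℝ) : ℝ :=
  (Module.finrank ℝ (topEigenspace G lam) : ℝ) ^ (1 / 3 : ℝ)

/-- The matrix of the orthogonal projector onto `V_{≥ lam}`. (The inner product of the uniform
measure is a multiple of the Euclidean one, so both have the same orthogonal projector.) -/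
def topProjector (G : SimpleGraph V) [DecidableRel G.Adj] (lam : ℝ) : Matrix V V ℝ :=
  Matrix.of fun u v => (topEigenspace G lam).starProjection (EuclideanSpace.single v (1 : ℝ)) u

end Graph

/-! ### Pseudo-expectations -/

section PseudoExpectation

variable {σ : Type*}

/-- `E` is a level-`ℓ` pseudo-expectation functional. Only the values of `E` on polynomials of
degree at most `ℓ` matter; every linear functional on those polynomials extends linearly to all
polynomials, so nothing is lost by taking a functional on the whole ring. -/
structure IsPseudoExpectation (ℓ : ℕ) (E : MvPolynomial σ ℝ →ₗ[ℝ] ℝ) : Prop where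
  normalization : E 1 = 1
  positivity : ∀ P : MvPolynomial σ ℝ, 2 * P.totalDegree ≤ ℓ → 0 ≤ E (P ^ 2)

/-- A level-`ℓ` pseudo-expectation is consistent with the constraint `P ≡ 0`, for a polynomial `P`
of degree at most `ℓ / 2`, if it gives `P ^ 2` the value `0`. -/
def IsConsistent (ℓ : ℕ) (E : MvPolynomial σ ℝ →ₗ[ℝ] ℝ) (P : MvPolynomial σ ℝ) : Prop :=
  2 * P.totalDegree ≤ ℓ ∧ E (P ^ 2) = 0

/-- The level-`ℓ` sum-of-squares relaxation of the system of polynomial equations `P = 0`,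
`P ∈ sys`, is feasible. -/
def SOSFeasible (ℓ : ℕ) (sys : Set (MvPolynomial σ ℝ)) : Prop :=
  ∃ E : MvPolynomial σ ℝ →ₗ[ℝ] ℝ, IsPseudoExpectation ℓ E ∧ ∀ P ∈ sys, IsConsistent ℓ E P

end PseudoExpectation

/-! ### The polynomial system -/

/-- The variables: the indicator function `f` of a vertex set, the truncation `g` of its
projection to the top eigenspace, and slack variables turning inequalities into equations. -/
inductive Var (V : Type*) where
  | f (v : V)
  | g (v : V)
  | slackLower (v : V)
  | slackUpper (v : V)
  | slackNorm
  | slackExpansion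

section System

open MvPolynomial

variable {V : Type*} [Fintype V] [DecidableEq V]

/-- The value at `u` of the projection of `f` to `V_{≥ lam}`, a linear form in the `f v`. -/
def projF (G : SimpleGraph V) [DecidableRel G.Adj] (lam : ℝ) (u : V) : MvPolynomial (Var V) ℝ :=
  ∑ v, C (topProjector G lam u v) * X (Var.f v)

/-- The value at `u` of the projection of `g` to `V_{≥ lam}`, a linear form in the `g v`. -/
def projG (G : SimpleGraph V) [DecidableRel G.Adj] (lam : ℝ) (u : V) : MvPolynomial (Var V) ℝ :=
  ∑ v, C (topProjector G lam u v) * X (Var.g v)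

/-- The polynomial system for vertex sets of size `k` and expansion at most `ε`. With `f` the
indicator function of the set, `Π` the projector to `V_{≥ lam}`, `n` the number of vertices, the
equations express, in this order,
* `f u ∈ {0, 1}` for every vertex `u`;
* `∑ u, f u = k`;
* the expansion of the set is at most `ε`;
* `c * g u ≤ (Π f) u ^ 2` and `-(c * g u) ≤ (Π f) u ^ 2` for every vertex `u`;
* `c * (k / n) ≤ (1 / n) ∑ u, (Π g) u ^ 4`.
An inequality `0 ≤ Q` is written as the equation `Q - y ^ 2 = 0` with a new variable `y`. -/
def system (G : SimpleGraph V) [DecidableRel G.Adj] (lam ε c : ℝ) (k : ℕ) :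
    Set (MvPolynomial (Var V) ℝ) :=
  {P | ∃ u, P = X (Var.f u) ^ 2 - X (Var.f u)} ∪
  {∑ u, X (Var.f u) - C (k : ℝ)} ∪
  {C (ε * k) - ∑ u, ∑ v, C (walkMatrix G u v) * (X (Var.f u) * (1 - X (Var.f v)))
    - X Var.slackExpansion ^ 2} ∪
  {P | ∃ u, P = projF G lam u ^ 2 - C c * X (Var.g u) - X (Var.slackLower u) ^ 2} ∪
  {P | ∃ u, P = projF G lam u ^ 2 + C c * X (Var.g u) - X (Var.slackUpper u) ^ 2} ∪
  {C (1 / (Fintype.card V : ℝ)) * ∑ u, projG G lam u ^ 4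
    - C (c * ((k : ℝ) / (Fintype.card V : ℝ))) - X Var.slackNorm ^ 2}

/-- The test based on the level-`ℓ` relaxations: accept if for some size `k ≥ 1` with
`k / |V| ≤ μ / (dim V_{≥ lam})^{1/3}` the level-`ℓ` relaxation of the system is feasible. -/
def SOSAccepts (G : SimpleGraph V) [DecidableRel G.Adj] (ℓ : ℕ) (lam ε c μ : ℝ) : Prop :=
  ∃ k : ℕ, 1 ≤ k ∧ (k : ℝ) / (Fintype.card V : ℝ) ≤ μ / dimFactor G lam ∧
    SOSFeasible ℓ (system G lam ε c k)

end System

end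

end SSE

/-!
The two directions of the test rest on one property of the top eigenspace `U = V_{≥ lam}`, with
projection matrix `P`: whether some vector of `U` has a four-norm much larger than its two-norm.

**Completeness.** If `S` has expansion at most `ε`, then the quadratic form of the walk at the
indicator function `f` of `S` is at least `(1 - ε) |S|`, whereas every bit of mass outside `U` costs
it at least `C ε`; so `∑ u, (f u - (P f) u) ^ 2 ≤ |S| / C` (`sum_walkMatrix_mul_le_sub`).
Restricting `f` to the points where `|P f|` is at least `1 / 2` gives a function `g` that, together
with `f`, solves the system (`sum_pow_four_mulVec_indicator_ge`, `sosFeasible_of_expansion_le`).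

**Soundness.** Suppose that all small sets expand almost perfectly. A Cheeger-type argument shows
that the walk nearly annihilates functions living on a small set, and interpolation with the trivial
bound in the sup-norm makes it a contraction there in the four-norm too. Vectors of `U` are almost
fixed by the walk, so they have no large four-norm: `∑ w ^ 4 ≤ a (∑ w ^ 2) ^ 2` on `U`, with `a` of
order `1 / (√μ n)` (`fourNormBound_of_expansion`).

This bound concerns actual vectors of `U`, and the pseudo-expectation `E` has to be refuted with it.
Two observations achieve this.
* For every square `q ^ 2` the matrix `E (q ^ 2 (P f) u (P f) v)` is positive semidefinite, hence a
  sum of squares of actual vectors of `U`. By the triangle inequality in the two-norm, its diagonal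
  satisfies `∑ u, E (q ^ 2 (P f) u ^ 2) ^ 2 ≤ a k ^ 2 E (q ^ 2) ^ 2`. Four applications bound the
  tensor `E ∏ i, (P f) (u i) ^ 2`, for four vertices `u i`, by `(a k ^ 2) ^ 4` in squared norm
  (`sum_sq_map_prod_projF_le`), and the constraints `± c g ≤ (P f) ^ 2` transfer the bound to the
  tensor `E ∏ i, g (u i)` (`abs_map_prod_g_le`).
* `E ∑ u, (P g) u ^ 4` is the inner product of this last tensor with `∑ u, (P u)^{⊗ 4}`, whose
  squared norm is `∑ u v, P u v ^ 4 ≤ a ^ 2 (dim U) ^ 2`, by the four-norm bound for the rows of `P`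
  (`sq_map_sum_projG_pow_le`, `FourNormBound.sum_pow_four_entries_le`).

By Cauchy–Schwarz `c ^ 5 ≤ (a k) ^ 3 dim U` (`pow_five_le_of_feasible`). The exponent `1 / 3` in the
bound on `k / n` cancels the dimension, and a large `C` makes the right-hand side too small.
-/

namespace SSE

open Matrix

/-! ### The random walk and its top eigenspace -/

section Spectral

variable {V : Type*} [Fintype V] {G : SimpleGraph V} [DecidableRel G.Adj]

theorem walkMatrix_nonneg (u v : V) : 0 ≤ walkMatrix G u v := by
  simp only [walkMatrix, Matrix.of_apply]
  split_ifs <;> positivity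

theorem walkMatrix_comm {D : ℕ} (hG : G.IsRegularOfDegree D) (u v : V) :
    walkMatrix G u v = walkMatrix G v u := by
  simp only [walkMatrix, Matrix.of_apply, hG.degree_eq, G.adj_comm u v]

theorem walkMatrix_row_sum {D : ℕ} (hD : 0 < D) (hG : G.IsRegularOfDegree D) (u : V) :
    ∑ v, walkMatrix G u v = 1 := by
  simp only [walkMatrix, Matrix.of_apply, ← Finset.sum_filter, Finset.sum_const, nsmul_eq_mul]
  rw [← G.neighborFinset_eq_filter, G.card_neighborFinset_eq_degree, hG.degree_eq]
  field_simp

theorem sum_walkMatrix_mul_le {D : ℕ} (hD : 0 < D) (hG : G.IsRegularOfDegree D) (x : V → ℝ) :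
    ∑ u, x u * (walkMatrix G *ᵥ x) u ≤ ∑ u, x u ^ 2 := by
  have h1 : ∑ u, ∑ v, walkMatrix G u v * x u ^ 2 = ∑ u, x u ^ 2 := by
    simp [← Finset.sum_mul, walkMatrix_row_sum hD hG]
  have h2 : ∑ u, ∑ v, walkMatrix G u v * x v ^ 2 = ∑ u, x u ^ 2 := by
    rw [Finset.sum_comm, ← h1]
    simp_rw [walkMatrix_comm hG]
  have h3 : ∑ u, x u * (walkMatrix G *ᵥ x) u ≤
      ∑ u, ∑ v, (walkMatrix G u v * x u ^ 2 + walkMatrix G u v * x v ^ 2) / 2 := by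
    simp only [Matrix.mulVec, dotProduct, Finset.mul_sum]
    refine Finset.sum_le_sum fun u _ => Finset.sum_le_sum fun v _ => ?_
    nlinarith [mul_nonneg (walkMatrix_nonneg (G := G) u v) (sq_nonneg (x u - x v))]
  simp only [← Finset.sum_div, Finset.sum_add_distrib, h1, h2] at h3
  linarith

theorem isHermitian_walkMatrix {D : ℕ} (hG : G.IsRegularOfDegree D) :
    (walkMatrix G).IsHermitian := by
  ext u v
  simp [walkMatrix_comm hG u v]

variable [DecidableEq V]

theorem toLp_topProjector_mulVec (lam : ℝ) (x : V → ℝ) :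
    WithLp.toLp 2 (topProjector G lam *ᵥ x) =
      (topEigenspace G lam).starProjection (WithLp.toLp 2 x) := by
  have hx : (WithLp.toLp 2 x : EuclideanSpace ℝ V) =
      ∑ v, x v • EuclideanSpace.single v (1 : ℝ) := by
    ext u
    simp [Finset.sum_apply, Pi.single_apply]
  rw [hx, map_sum]
  ext u
  simp [Matrix.mulVec, dotProduct, topProjector, mul_comm]

theorem topProjector_comm (lam : ℝ) (u v : V) :
    topProjector G lam u v = topProjector G lam v u := by
  have h := (topEigenspace G lam).starProjection_isSymmetric
    (EuclideanSpace.single u (1 : ℝ)) (EuclideanSpace.single v 1)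
  simpa [topProjector, EuclideanSpace.inner_single_left, EuclideanSpace.inner_single_right]
    using h.symm

theorem topProjector_mulVec_mulVec (lam : ℝ) (x : V → ℝ) :
    topProjector G lam *ᵥ (topProjector G lam *ᵥ x) = topProjector G lam *ᵥ x := by
  apply WithLp.toLp_injective 2
  rw [toLp_topProjector_mulVec, toLp_topProjector_mulVec]
  exact Submodule.starProjection_eq_self_iff.2 (Submodule.starProjection_apply_mem _ _)

theorem topProjector_mul_self (lam : ℝ) :
    topProjector G lam * topProjector G lam = topProjector G lam := by
  apply Matrix.ext_of_mulVec_single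
  intro i
  rw [← Matrix.mulVec_mulVec, topProjector_mulVec_mulVec]

theorem trace_topProjector (lam : ℝ) :
    ∑ u, topProjector G lam u u = Module.finrank ℝ (topEigenspace G lam) := by
  have hproj : LinearMap.IsProj (topEigenspace G lam)
      ((topEigenspace G lam).starProjection : EuclideanSpace ℝ V →ₗ[ℝ] EuclideanSpace ℝ V) :=
    ⟨fun x => (topEigenspace G lam).starProjection_apply_mem x, fun x hx =>
      (Submodule.starProjection_eq_self_iff).2 hx⟩
  rw [← hproj.trace, LinearMap.trace_eq_matrix_trace ℝ (EuclideanSpace.basisFun V ℝ).toBasis]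
  simp [Matrix.trace, LinearMap.toMatrix_apply, topProjector]

section Basis

variable (hW : (walkMatrix G).IsHermitian)

theorem toEuclideanLin_eigenvectorBasis (i : V) :
    Matrix.toEuclideanLin (walkMatrix G) (hW.eigenvectorBasis i) =
      hW.eigenvalues i • hW.eigenvectorBasis i := by
  have h := hW.mulVec_eigenvectorBasis i
  apply WithLp.ofLp_injective 2
  simpa using h

theorem inner_eigenvectorBasis_toEuclideanLin (i : V) (x : EuclideanSpace ℝ V) :
    inner ℝ (hW.eigenvectorBasis i) (Matrix.toEuclideanLin (walkMatrix G) x) =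
      hW.eigenvalues i * inner ℝ (hW.eigenvectorBasis i) x := by
  rw [← (Matrix.isSymmetric_toEuclideanLin_iff.2 hW), toEuclideanLin_eigenvectorBasis,
    real_inner_smul_left]

theorem inner_eigenvectorBasis_starProjection (lam : ℝ) (i : V) (x : EuclideanSpace ℝ V) :
    inner ℝ (hW.eigenvectorBasis i) ((topEigenspace G lam).starProjection x) =
      if lam ≤ hW.eigenvalues i then inner ℝ (hW.eigenvectorBasis i) x else 0 := by
  split_ifs with h
  · have hb : hW.eigenvectorBasis i ∈ topEigenspace G lam := by
      refine Submodule.mem_iSup_of_mem (hW.eigenvalues i) (Submodule.mem_iSup_of_mem h ?_)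
      exact Module.End.mem_eigenspace_iff.2 (toEuclideanLin_eigenvectorBasis hW i)
    have hs := (topEigenspace G lam).starProjection_isSymmetric (hW.eigenvectorBasis i) x
    rw [ContinuousLinearMap.coe_coe, (Submodule.starProjection_eq_self_iff).2 hb] at hs
    exact hs.symm
  · have hle : topEigenspace G lam ≤ (ℝ ∙ hW.eigenvectorBasis i)ᗮ := by
      refine iSup₂_le fun η hη y hy => ?_
      rw [Submodule.mem_orthogonal_singleton_iff_inner_right]
      have hy' := Module.End.mem_eigenspace_iff.1 hy
      have h1 := inner_eigenvectorBasis_toEuclideanLin hW i y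
      rw [hy', real_inner_smul_right] at h1
      have h2 : (η - hW.eigenvalues i) * inner ℝ (hW.eigenvectorBasis i) y = 0 := by linarith
      have h3 : η - hW.eigenvalues i ≠ 0 := by
        have : lam ≤ η := hη
        intro h0
        exact h (by linarith)
      exact (mul_eq_zero.1 h2).resolve_left h3
    exact Submodule.mem_orthogonal_singleton_iff_inner_right.1
      (hle ((topEigenspace G lam).starProjection_apply_mem x))

end Basis

theorem eigenvalues_walkMatrix_le_one {D : ℕ} (hD : 0 < D) (hG : G.IsRegularOfDegree D)
    (hW : (walkMatrix G).IsHermitian) (i : V) : hW.eigenvalues i ≤ 1 := by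
  have h := sum_walkMatrix_mul_le hD hG (hW.eigenvectorBasis i).ofLp
  rw [hW.mulVec_eigenvectorBasis i] at h
  have h1 : ∑ u, (hW.eigenvectorBasis i).ofLp u ^ 2 = 1 := by
    rw [← EuclideanSpace.real_norm_sq_eq, hW.eigenvectorBasis.orthonormal.1 i, one_pow]
  have h2 : ∑ u, (hW.eigenvectorBasis i).ofLp u *
      (hW.eigenvalues i • (hW.eigenvectorBasis i).ofLp) u = hW.eigenvalues i := by
    calc _ = hW.eigenvalues i * ∑ u, (hW.eigenvectorBasis i).ofLp u ^ 2 := by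
          rw [Finset.mul_sum]
          refine Finset.sum_congr rfl fun u _ => ?_
          rw [Pi.smul_apply, smul_eq_mul]
          ring
      _ = _ := by rw [h1, mul_one]
  linarith

theorem walkMatrix_mulVec_topProjector {D : ℕ} (hG : G.IsRegularOfDegree D) (lam : ℝ)
    (x : V → ℝ) :
    walkMatrix G *ᵥ (topProjector G lam *ᵥ x) = topProjector G lam *ᵥ (walkMatrix G *ᵥ x) := by
  have hW := isHermitian_walkMatrix hG
  have hT : ∀ y : V → ℝ, WithLp.toLp 2 (walkMatrix G *ᵥ y) =
      Matrix.toEuclideanLin (walkMatrix G) (WithLp.toLp 2 y) := fun y => rfl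
  apply WithLp.toLp_injective 2
  rw [toLp_topProjector_mulVec, hT, hT, toLp_topProjector_mulVec]
  apply hW.eigenvectorBasis.repr.injective
  ext i
  simp only [OrthonormalBasis.repr_apply_apply, inner_eigenvectorBasis_toEuclideanLin,
    inner_eigenvectorBasis_starProjection]
  split_ifs <;> simp

/-- On the top eigenspace the walk is close to the identity. -/
theorem sum_sq_sub_walkMatrix_le {D : ℕ} (hD : 0 < D) (hG : G.IsRegularOfDegree D) {lam : ℝ}
    {w : V → ℝ} (hw : topProjector G lam *ᵥ w = w) :
    ∑ u, (w u - (walkMatrix G *ᵥ w) u) ^ 2 ≤ (1 - lam) ^ 2 * ∑ u, w u ^ 2 := by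
  have hW := isHermitian_walkMatrix hG
  have e1 : ∑ u, (w u - (walkMatrix G *ᵥ w) u) ^ 2 =
      ‖WithLp.toLp 2 w - Matrix.toEuclideanLin (walkMatrix G) (WithLp.toLp 2 w)‖ ^ 2 := by
    rw [EuclideanSpace.real_norm_sq_eq]
    simp
  have e2 : ∑ u, w u ^ 2 = ‖(WithLp.toLp 2 w : EuclideanSpace ℝ V)‖ ^ 2 := by
    rw [EuclideanSpace.real_norm_sq_eq]
  rw [e1, e2, ← hW.eigenvectorBasis.sum_sq_norm_inner_right,
    ← hW.eigenvectorBasis.sum_sq_norm_inner_right, Finset.mul_sum]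
  refine Finset.sum_le_sum fun i _ => ?_
  rw [inner_sub_right, inner_eigenvectorBasis_toEuclideanLin, Real.norm_eq_abs, Real.norm_eq_abs,
    sq_abs, sq_abs]
  have h1 := inner_eigenvectorBasis_starProjection hW lam i (WithLp.toLp 2 w)
  rw [← toLp_topProjector_mulVec, hw] at h1
  split_ifs at h1 with h
  · have h2 := eigenvalues_walkMatrix_le_one hD hG hW i
    rw [← one_sub_mul, mul_pow]
    gcongr
  · simp [h1]

/-- A large quadratic form forces a vector to be close to the top eigenspace. -/
theorem sum_walkMatrix_mul_le_sub {D : ℕ} (hD : 0 < D) (hG : G.IsRegularOfDegree D) (lam : ℝ)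
    (x : V → ℝ) :
    ∑ u, x u * (walkMatrix G *ᵥ x) u ≤
      ∑ u, x u ^ 2 - (1 - lam) * ∑ u, (x u - (topProjector G lam *ᵥ x) u) ^ 2 := by
  have hW := isHermitian_walkMatrix hG
  have e0 : ∑ u, x u * (walkMatrix G *ᵥ x) u = inner ℝ (WithLp.toLp 2 x)
      (Matrix.toEuclideanLin (walkMatrix G) (WithLp.toLp 2 x)) := by
    simp [PiLp.inner_apply, mul_comm]
  have e1 : ∑ u, (x u - (topProjector G lam *ᵥ x) u) ^ 2 =
      ‖WithLp.toLp 2 x - (topEigenspace G lam).starProjection (WithLp.toLp 2 x)‖ ^ 2 := by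
    rw [← toLp_topProjector_mulVec, EuclideanSpace.real_norm_sq_eq]
    simp
  have e2 : ∑ u, x u ^ 2 = ‖(WithLp.toLp 2 x : EuclideanSpace ℝ V)‖ ^ 2 := by
    rw [EuclideanSpace.real_norm_sq_eq]
  rw [e0, e1, e2, ← hW.eigenvectorBasis.sum_sq_norm_inner_right,
    ← hW.eigenvectorBasis.sum_sq_norm_inner_right, ← hW.eigenvectorBasis.sum_inner_mul_inner,
    Finset.mul_sum, ← Finset.sum_sub_distrib]
  refine Finset.sum_le_sum fun i _ => ?_
  rw [inner_sub_right, inner_eigenvectorBasis_toEuclideanLin,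
    inner_eigenvectorBasis_starProjection, Real.norm_eq_abs, Real.norm_eq_abs,
    sq_abs, sq_abs, real_inner_comm]
  have h2 := eigenvalues_walkMatrix_le_one hD hG hW i
  split_ifs with h
  · simp only [sub_self]
    nlinarith [sq_nonneg (inner ℝ (hW.eigenvectorBasis i) (WithLp.toLp 2 x) : ℝ)]
  · push Not at h
    nlinarith [sq_nonneg (inner ℝ (hW.eigenvectorBasis i) (WithLp.toLp 2 x) : ℝ)]

end Spectral

/-! ### The walk on small sets -/

section SmallSets

variable {V : Type*} [Fintype V] [DecidableEq V] {W : Matrix V V ℝ} {θ : ℝ} {T : Finset V}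

/-- The layer-cake inequality: a bound on the weight inside every subset of `T` extends from
indicator functions to nonnegative functions supported on `T`. The proof peels off the smallest
positive value of the function. -/
theorem sum_mul_min_le {η : ℝ}
    (hT : ∀ S ⊆ T, S.Nonempty → ∑ u ∈ S, ∑ v ∈ S, W u v ≤ η * S.card)
    (a : V → ℝ) (ha : ∀ u, 0 ≤ a u) (haT : ∀ u, u ∉ T → a u = 0) :
    ∑ u, ∑ v, W u v * min (a u) (a v) ≤ η * ∑ u, a u := by
  induction h : #{u | 0 < a u} using Nat.strong_induction_on generalizing a with
  | _ N ih =>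
  set S : Finset V := {u | 0 < a u} with hS
  have hS0 : ∀ u, u ∉ S → a u = 0 := fun u hu =>
    le_antisymm (by simpa [hS] using hu) (ha u)
  have hST : S ⊆ T := fun u hu => by
    by_contra hn
    have h1 : 0 < a u := by simpa [hS] using hu
    exact h1.ne' (haT u hn)
  rcases S.eq_empty_or_nonempty with hE | hne
  · have h0 : ∀ u, a u = 0 := fun u => hS0 u (by simp [hE])
    simp [h0]
  · obtain ⟨u₀, hu₀, hmin⟩ := S.exists_min_image a hne
    have hpos : 0 < a u₀ := by simpa [hS] using hu₀
    set b : V → ℝ := fun u => if u ∈ S then a u - a u₀ else 0 with hb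
    have hb0 : ∀ u, 0 ≤ b u := fun u => by
      simp only [hb]
      split_ifs with hu
      · linarith [hmin u hu]
      · exact le_rfl
    have hbT : ∀ u, u ∉ T → b u = 0 := fun u hu => by
      simp only [hb]
      exact if_neg fun h' => hu (hST h')
    have hlt : #{u | 0 < b u} < N := by
      rw [← h]
      refine Finset.card_lt_card ⟨fun u hu => ?_, fun hsub => ?_⟩
      · by_contra hn
        have : 0 < b u := by simpa using hu
        simp [hb, hn] at this
      · have := hsub hu₀
        simp [hb, hu₀] at this
    have hrec := ih _ hlt b hb0 hbT rfl
    have hsplit : ∀ u v, min (a u) (a v) =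
        (if u ∈ S then if v ∈ S then a u₀ else 0 else 0) + min (b u) (b v) := fun u v => by
      by_cases hu : u ∈ S <;> by_cases hv : v ∈ S
      · simp only [hb, hu, hv, if_true]
        rw [min_sub_sub_right]
        ring
      · simp [hb, hu, hv, hS0 v hv, hmin u hu, ha u]
      · simp [hb, hu, hv, hS0 u hu, hmin v hv, ha v]
      · simp [hb, hu, hv, hS0 u hu, hS0 v hv]
    have hasum : ∀ u, a u = (if u ∈ S then a u₀ else 0) + b u := fun u => by
      by_cases hu : u ∈ S
      · simp [hb, hu]
      · simp [hb, hu, hS0 u hu]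
    have e1 : ∑ u, ∑ v, W u v * min (a u) (a v) =
        a u₀ * ∑ u ∈ S, ∑ v ∈ S, W u v + ∑ u, ∑ v, W u v * min (b u) (b v) := by
      simp only [hsplit, mul_add, Finset.sum_add_distrib, Finset.mul_sum]
      congr 1
      rw [← Finset.sum_filter_add_sum_filter_not univ (· ∈ S)]
      rw [Finset.sum_eq_zero (s := {x | x ∉ S}), add_zero]
      · rw [Finset.filter_univ_mem]
        refine Finset.sum_congr rfl fun u hu => ?_
        simp only [hu, if_true, mul_ite, mul_zero, ← Finset.sum_filter, Finset.filter_univ_mem]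
        exact Finset.sum_congr rfl fun v _ => mul_comm _ _
      · intro u hu
        have : u ∉ S := by simpa using hu
        simp [this]
    have e2 : ∑ u, a u = a u₀ * S.card + ∑ u, b u := by
      rw [Finset.sum_congr rfl fun u _ => hasum u, Finset.sum_add_distrib]
      simp [mul_comm]
    rw [e1, e2]
    nlinarith [mul_le_mul_of_nonneg_left (hT S hST hne) hpos.le]

variable (hW0 : ∀ u v, 0 ≤ W u v) (hWs : ∀ u v, W u v = W v u) (hW1 : ∀ u, ∑ v, W u v = 1)
include hW0 hWs hW1

/-- A Cheeger-type inequality: small weight inside all subsets of `T` bounds the quadratic form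
of `W` on functions supported on `T`. -/
theorem sum_mul_mulVec_le (hθ : 0 < θ)
    (hT : ∀ S ⊆ T, S.Nonempty → ∑ u ∈ S, ∑ v ∈ S, W u v ≤ 2 * θ ^ 2 * S.card)
    (x : V → ℝ) (hxT : ∀ u, u ∉ T → x u = 0) :
    ∑ u, x u * (W *ᵥ x) u ≤ 2 * θ * ∑ u, x u ^ 2 := by
  have h0 := sum_mul_min_le hT (fun u => x u ^ 2) (fun u => sq_nonneg _)
    (fun u hu => by simp [hxT u hu])
  have h1 : ∑ u, ∑ v, W u v * x u ^ 2 = ∑ u, x u ^ 2 := by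
    simp [← Finset.sum_mul, hW1]
  have h2 : ∑ u, ∑ v, W u v * x v ^ 2 = ∑ u, x u ^ 2 := by
    rw [Finset.sum_comm, ← h1]
    simp_rw [hWs]
  have key : ∀ u v, x u * x v ≤
      θ / 2 * (x u ^ 2 + x v ^ 2) + 1 / (2 * θ) * min (x u ^ 2) (x v ^ 2) := by
    have aux : ∀ p q : ℝ, p * q ≤ θ / 2 * (p ^ 2 + q ^ 2) + 1 / (2 * θ) * p ^ 2 := by
      intro p q
      have e : θ / 2 * (p ^ 2 + q ^ 2) + 1 / (2 * θ) * p ^ 2 - p * q =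
          θ / 2 * p ^ 2 + θ / 2 * (q - p / θ) ^ 2 := by
        field_simp
        ring
      have : 0 ≤ θ / 2 * p ^ 2 + θ / 2 * (q - p / θ) ^ 2 := by positivity
      linarith
    intro u v
    rcases le_total (x u ^ 2) (x v ^ 2) with h | h
    · rw [min_eq_left h]
      exact aux _ _
    · rw [min_eq_right h]
      have := aux (x v) (x u)
      linarith
  have h3 : ∑ u, x u * (W *ᵥ x) u ≤ ∑ u, ∑ v, (θ / 2 * (W u v * x u ^ 2) +
      θ / 2 * (W u v * x v ^ 2) + 1 / (2 * θ) * (W u v * min (x u ^ 2) (x v ^ 2))) := by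
    simp only [Matrix.mulVec, dotProduct, Finset.mul_sum]
    refine Finset.sum_le_sum fun u _ => Finset.sum_le_sum fun v _ => ?_
    have := mul_le_mul_of_nonneg_left (key u v) (hW0 u v)
    linarith
  simp only [Finset.sum_add_distrib, ← Finset.mul_sum, h1, h2] at h3
  have h4 : 1 / (2 * θ) * ∑ u, ∑ v, W u v * min (x u ^ 2) (x v ^ 2) ≤ θ * ∑ u, x u ^ 2 := by
    calc _ ≤ 1 / (2 * θ) * (2 * θ ^ 2 * ∑ u, x u ^ 2) := by gcongr
      _ = _ := by field_simp
  linarith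

/-- Small weight inside all subsets of `T` bounds the operator norm of the restriction of `W` to
functions on `T`. -/
theorem sum_sq_mulVec_le (hθ : 0 < θ)
    (hT : ∀ S ⊆ T, S.Nonempty → ∑ u ∈ S, ∑ v ∈ S, W u v ≤ 2 * θ ^ 2 * S.card)
    (x : V → ℝ) (hxT : ∀ u, u ∉ T → x u = 0) :
    ∑ u ∈ T, (W *ᵥ x) u ^ 2 ≤ 4 * θ ^ 2 * ∑ u, x u ^ 2 := by
  have hquad : ∀ (s : ℝ) (_ : |s| = 1) (z : V → ℝ) (_ : ∀ u, u ∉ T → z u = 0),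
      s * ∑ u, z u * (W *ᵥ z) u ≤ 2 * θ * ∑ u, z u ^ 2 := by
    intro s hs z hz
    have h := sum_mul_mulVec_le hW0 hWs hW1 hθ hT (fun u => |z u|)
      (fun u hu => by simp [hz u hu])
    simp only [sq_abs] at h
    refine le_trans ?_ h
    simp only [Matrix.mulVec, dotProduct, Finset.mul_sum]
    refine Finset.sum_le_sum fun u _ => Finset.sum_le_sum fun v _ => ?_
    calc s * (z u * (W u v * z v)) ≤ |s * (z u * (W u v * z v))| := le_abs_self _
      _ = _ := by rw [abs_mul, hs, abs_mul, abs_mul, abs_of_nonneg (hW0 u v), one_mul]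
  set y : V → ℝ := fun u => if u ∈ T then (W *ᵥ x) u else 0 with hy
  have hyT : ∀ u, u ∉ T → y u = 0 := fun u hu => by simp [hy, hu]
  have hyW : ∑ u, y u * (W *ᵥ x) u = ∑ u, y u ^ 2 := by
    refine Finset.sum_congr rfl fun u _ => ?_
    simp only [hy]
    split_ifs <;> ring
  have hWy : ∑ u, x u * (W *ᵥ y) u = ∑ u, y u ^ 2 := by
    rw [← hyW]
    simp only [Matrix.mulVec, dotProduct, Finset.mul_sum]
    rw [Finset.sum_comm]
    refine Finset.sum_congr rfl fun u _ => Finset.sum_congr rfl fun v _ => ?_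
    rw [hWs u v]
    ring
  have hsum : ∑ u ∈ T, (W *ᵥ x) u ^ 2 = ∑ u, y u ^ 2 := by
    simp [hy, ite_pow]
  -- Polarization with the multiple `1 / (2θ)` of `y`, the optimal one.
  set t : ℝ := 1 / (2 * θ) with ht
  have hp := hquad 1 (by simp) (x + t • y) (fun u hu => by simp [hxT u hu, hyT u hu])
  have hm := hquad (-1) (by simp) (x - t • y) (fun u hu => by simp [hxT u hu, hyT u hu])
  have ep : ∑ u, (x + t • y) u * (W *ᵥ (x + t • y)) u =
      ∑ u, x u * (W *ᵥ x) u + 2 * t * ∑ u, y u ^ 2 + t ^ 2 * ∑ u, y u * (W *ᵥ y) u := by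
    simp only [Matrix.mulVec_add, Matrix.mulVec_smul, Pi.add_apply, Pi.smul_apply, smul_eq_mul]
    calc _ = ∑ u, (x u * (W *ᵥ x) u + t * (x u * (W *ᵥ y) u) + t * (y u * (W *ᵥ x) u)
          + t ^ 2 * (y u * (W *ᵥ y) u)) := Finset.sum_congr rfl fun u _ => by ring
      _ = _ := by
        simp only [Finset.sum_add_distrib, ← Finset.mul_sum, hyW, hWy]
        ring
  have em : ∑ u, (x - t • y) u * (W *ᵥ (x - t • y)) u =
      ∑ u, x u * (W *ᵥ x) u - 2 * t * ∑ u, y u ^ 2 + t ^ 2 * ∑ u, y u * (W *ᵥ y) u := by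
    simp only [Matrix.mulVec_sub, Matrix.mulVec_smul, Pi.sub_apply, Pi.smul_apply, smul_eq_mul]
    calc _ = ∑ u, (x u * (W *ᵥ x) u - t * (x u * (W *ᵥ y) u) - t * (y u * (W *ᵥ x) u)
          + t ^ 2 * (y u * (W *ᵥ y) u)) := Finset.sum_congr rfl fun u _ => by ring
      _ = _ := by
        simp only [Finset.sum_add_distrib, Finset.sum_sub_distrib, ← Finset.mul_sum, hyW, hWy]
        ring
  have en : ∑ u, (x + t • y) u ^ 2 + ∑ u, (x - t • y) u ^ 2 =
      2 * ∑ u, x u ^ 2 + 2 * t ^ 2 * ∑ u, y u ^ 2 := by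
    simp only [Finset.mul_sum, ← Finset.sum_add_distrib]
    refine Finset.sum_congr rfl fun u _ => ?_
    simp only [Pi.add_apply, Pi.sub_apply, Pi.smul_apply, smul_eq_mul]
    ring
  rw [ep] at hp
  rw [em] at hm
  rw [hsum]
  have h5 : 4 * t * ∑ u, y u ^ 2 ≤ 2 * θ * (2 * ∑ u, x u ^ 2 + 2 * t ^ 2 * ∑ u, y u ^ 2) := by
    rw [← en]
    linarith
  have h6 : 4 * θ ^ 2 * ∑ u, x u ^ 2 - ∑ u, y u ^ 2 =
      θ * (2 * θ * (2 * ∑ u, x u ^ 2 + 2 * t ^ 2 * ∑ u, y u ^ 2) - 4 * t * ∑ u, y u ^ 2) := by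
    rw [ht]
    field_simp
    ring
  have h7 := mul_nonneg hθ.le (sub_nonneg.2 h5)
  linarith

omit [DecidableEq V] hWs in
theorem sq_mulVec_le (x : V → ℝ) (u : V) : (W *ᵥ x) u ^ 2 ≤ (W *ᵥ fun v => x v ^ 2) u := by
  have := Finset.sum_sq_le_sum_mul_sum_of_sq_le_mul univ (r := fun v => W u v * x v)
    (f := fun v => W u v) (g := fun v => W u v * x v ^ 2) (fun v _ => hW0 u v)
    (fun v _ => mul_nonneg (hW0 u v) (sq_nonneg _)) (fun v _ => le_of_eq (by ring))
  rw [hW1, one_mul] at this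
  exact this

/-- Four-norm version of `sum_sq_mulVec_le`. -/
theorem sum_pow_four_mulVec_le (hθ : 0 < θ)
    (hT : ∀ S ⊆ T, S.Nonempty → ∑ u ∈ S, ∑ v ∈ S, W u v ≤ 2 * θ ^ 2 * S.card)
    (x : V → ℝ) (hxT : ∀ u, u ∉ T → x u = 0) :
    ∑ u ∈ T, (W *ᵥ x) u ^ 4 ≤ 4 * θ ^ 2 * ∑ u, x u ^ 4 := by
  have h := sum_sq_mulVec_le hW0 hWs hW1 hθ hT (fun u => x u ^ 2)
    (fun u hu => by simp [hxT u hu])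
  calc _ ≤ ∑ u ∈ T, (W *ᵥ fun v => x v ^ 2) u ^ 2 := Finset.sum_le_sum fun u _ => by
        have h1 := sq_mulVec_le hW0 hW1 x u
        have h2 := pow_le_pow_left₀ (sq_nonneg _) h1 2
        calc _ = ((W *ᵥ x) u ^ 2) ^ 2 := by ring
          _ ≤ _ := h2
    _ ≤ _ := h
    _ = _ := by
      congr 1
      exact Finset.sum_congr rfl fun u _ => by ring

/-- A vector that `W` almost fixes has a small four-norm if small sets carry little weight: above
the threshold `s / M` for `w ^ 2` the walk contracts the four-norm, and below it the four-norm is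
controlled by the threshold. -/
theorem sum_pow_four_le_of_small_sets (hθ : 0 < θ) {M : ℝ} (hM : 0 < M)
    (hS : ∀ S : Finset V, S.Nonempty → (S.card : ℝ) ≤ M →
      ∑ u ∈ S, ∑ v ∈ S, W u v ≤ 2 * θ ^ 2 * S.card) (w : V → ℝ) :
    ∑ u, w u ^ 4 ≤ 28 / M * (∑ u, w u ^ 2) ^ 2 +
      27 * (4 * θ ^ 2 * ∑ u, w u ^ 4 + ∑ u, (w u - (W *ᵥ w) u) ^ 4) := by
  set s := ∑ u, w u ^ 2 with hs
  have hs0 : 0 ≤ s := Finset.sum_nonneg fun u _ => sq_nonneg _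
  rcases hs0.eq_or_lt with h0 | hspos
  · have hw : ∀ u, w u = 0 := fun u => by
      have := (Finset.sum_eq_zero_iff_of_nonneg (fun u _ => sq_nonneg (w u))).1 h0.symm u
        (Finset.mem_univ u)
      exact pow_eq_zero_iff two_ne_zero |>.1 this
    simp only [hw]
    have : 0 ≤ 28 / M * s ^ 2 := by positivity
    simp only [ne_eq, OfNat.ofNat_ne_zero, not_false_eq_true, zero_pow, Finset.sum_const_zero]
    have h4 : 0 ≤ ∑ u, (0 - (W *ᵥ w) u) ^ 4 := Finset.sum_nonneg fun u _ => by positivity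
    linarith
  set T : Finset V := {u | s / M ≤ w u ^ 2} with hTdef
  have hcard : (T.card : ℝ) ≤ M := by
    have h1 : (T.card : ℝ) * (s / M) ≤ s := by
      calc (T.card : ℝ) * (s / M) = ∑ u ∈ T, s / M := by simp
        _ ≤ ∑ u ∈ T, w u ^ 2 := Finset.sum_le_sum fun u hu => by
            simpa [hTdef] using hu
        _ ≤ s := Finset.sum_le_sum_of_subset_of_nonneg (Finset.subset_univ _)
            fun u _ _ => sq_nonneg _
    rw [← mul_div_assoc, div_le_iff₀ hM, mul_comm] at h1
    exact le_of_mul_le_mul_left h1 hspos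
  have hT : ∀ S ⊆ T, S.Nonempty → ∑ u ∈ S, ∑ v ∈ S, W u v ≤ 2 * θ ^ 2 * S.card :=
    fun S hST hne => hS S hne (le_trans (by exact_mod_cast Finset.card_le_card hST) hcard)
  have hoff : ∀ u, u ∉ T → w u ^ 2 ≤ s / M := fun u hu => by
    have : w u ^ 2 < s / M := by simpa [hTdef] using hu
    exact this.le
  set x : V → ℝ := fun u => if u ∈ T then w u else 0 with hx
  set y : V → ℝ := fun u => if u ∈ T then 0 else w u with hy
  have hxy : w = x + y := by
    ext u
    simp only [hx, hy, Pi.add_apply]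
    split_ifs <;> simp
  have hα : ∑ u ∈ T, (W *ᵥ x) u ^ 4 ≤ 4 * θ ^ 2 * ∑ u, w u ^ 4 := by
    refine (sum_pow_four_mulVec_le hW0 hWs hW1 hθ hT x (fun u hu => by simp [hx, hu])).trans ?_
    refine mul_le_mul_of_nonneg_left (Finset.sum_le_sum fun u _ => ?_) (by positivity)
    simp only [hx]
    split_ifs
    · exact le_rfl
    · rw [zero_pow four_ne_zero]
      positivity
  have hβ : ∀ u, (W *ᵥ y) u ^ 2 ≤ s / M := fun u => by
    refine (sq_mulVec_le hW0 hW1 y u).trans ?_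
    calc (W *ᵥ fun v => y v ^ 2) u ≤ ∑ v, W u v * (s / M) :=
          Finset.sum_le_sum fun v _ => by
            have hsM : 0 ≤ s / M := div_nonneg hs0 hM.le
            refine mul_le_mul_of_nonneg_left ?_ (hW0 u v)
            simp only [hy]
            split_ifs with hv
            · simpa using hsM
            · exact hoff v hv
      _ = s / M := by rw [← Finset.sum_mul, hW1, one_mul]
  have hβ4 : ∑ u ∈ T, (W *ᵥ y) u ^ 4 ≤ s ^ 2 / M := by
    calc _ ≤ ∑ u ∈ T, (s / M) ^ 2 := Finset.sum_le_sum fun u _ => by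
          calc (W *ᵥ y) u ^ 4 = ((W *ᵥ y) u ^ 2) ^ 2 := by ring
            _ ≤ _ := pow_le_pow_left₀ (sq_nonneg _) (hβ u) 2
      _ = T.card * (s / M) ^ 2 := by simp
      _ ≤ M * (s / M) ^ 2 := by gcongr
      _ = _ := by field_simp
  have hr : ∑ u ∈ T, (w u - (W *ᵥ w) u) ^ 4 ≤ ∑ u, (w u - (W *ᵥ w) u) ^ 4 :=
    Finset.sum_le_sum_of_subset_of_nonneg (Finset.subset_univ _) fun u _ _ => by positivity
  have hconv : ∀ p q r : ℝ, (p + q + r) ^ 4 ≤ 27 * (p ^ 4 + q ^ 4 + r ^ 4) := fun p q r => by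
    have h1 : (p + q + r) ^ 2 ≤ 3 * (p ^ 2 + q ^ 2 + r ^ 2) := by
      nlinarith [sq_nonneg (p - q), sq_nonneg (q - r), sq_nonneg (p - r)]
    have h2 := pow_le_pow_left₀ (sq_nonneg _) h1 2
    nlinarith [sq_nonneg (p ^ 2 - q ^ 2), sq_nonneg (q ^ 2 - r ^ 2), sq_nonneg (p ^ 2 - r ^ 2)]
  have hon : ∑ u ∈ T, w u ^ 4 ≤ 27 * (∑ u ∈ T, (W *ᵥ x) u ^ 4 + ∑ u ∈ T, (W *ᵥ y) u ^ 4 +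
      ∑ u ∈ T, (w u - (W *ᵥ w) u) ^ 4) := by
    rw [← Finset.sum_add_distrib, ← Finset.sum_add_distrib, Finset.mul_sum]
    refine Finset.sum_le_sum fun u _ => ?_
    refine le_of_eq_of_le ?_ (hconv _ _ _)
    congr 1
    have : (W *ᵥ w) u = (W *ᵥ x) u + (W *ᵥ y) u := by
      rw [hxy, Matrix.mulVec_add, Pi.add_apply]
    linarith
  have hoffsum : ∑ u ∈ Tᶜ, w u ^ 4 ≤ s ^ 2 / M := by
    calc _ ≤ ∑ u ∈ Tᶜ, s / M * w u ^ 2 := Finset.sum_le_sum fun u hu => by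
          have := hoff u (by simpa using hu)
          nlinarith [sq_nonneg (w u)]
      _ ≤ ∑ u, s / M * w u ^ 2 :=
          Finset.sum_le_sum_of_subset_of_nonneg (Finset.subset_univ _) fun u _ _ => by positivity
      _ = _ := by
        rw [← Finset.mul_sum]
        ring
  rw [← Finset.sum_add_sum_compl T]
  rw [← Finset.sum_add_sum_compl T] at hα
  have e : 28 / M * s ^ 2 = 28 * (s ^ 2 / M) := by ring
  linarith

end SmallSets

/-! ### Hypercontractivity -/

section FourNorm

variable {V : Type*} [Fintype V]

/-- A quantitative form of hypercontractivity for the range of the projection `P`: the fourth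
power of the four-norm is at most `a` times the fourth power of the two-norm. Both norms are with
respect to the counting measure. -/
def FourNormBound (P : Matrix V V ℝ) (a : ℝ) : Prop :=
  ∀ w : V → ℝ, P *ᵥ w = w → ∑ u, w u ^ 4 ≤ a * (∑ u, w u ^ 2) ^ 2

theorem sum_pow_four_le_sq_sum_sq (w : V → ℝ) : ∑ u, w u ^ 4 ≤ (∑ u, w u ^ 2) ^ 2 := by
  calc ∑ u, w u ^ 4 = ∑ u, (w u ^ 2) ^ 2 := Finset.sum_congr rfl fun u _ => by ring
    _ ≤ _ := Finset.sum_sq_le_sq_sum_of_nonneg fun u _ => sq_nonneg _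

/-- A four-norm bound that can be halved up to an additive error `b` holds with constant `2b`. -/
theorem FourNormBound.of_half {P : Matrix V V ℝ} {b : ℝ}
    (h : ∀ a, 0 ≤ a → FourNormBound P a → FourNormBound P (b + a / 2)) (hb : 0 ≤ b) :
    FourNormBound P (2 * b) := by
  have hj : ∀ j : ℕ, FourNormBound P (2 * b + (1 / 2) ^ j) := by
    intro j
    induction j with
    | zero =>
      intro w _
      refine (sum_pow_four_le_sq_sum_sq w).trans ?_
      have : 0 ≤ b * (∑ u, w u ^ 2) ^ 2 := by positivity
      rw [pow_zero]
      linarith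
    | succ j ih =>
      have := h _ (by positivity) ih
      convert this using 1
      ring
  intro w hw
  have hlim : Filter.Tendsto (fun j : ℕ => (2 * b + (1 / 2 : ℝ) ^ j) * (∑ u, w u ^ 2) ^ 2)
      Filter.atTop (nhds ((2 * b + 0) * (∑ u, w u ^ 2) ^ 2)) :=
    ((tendsto_pow_atTop_nhds_zero_of_lt_one (by norm_num) (by norm_num)).const_add _).mul_const _
  rw [add_zero] at hlim
  exact ge_of_tendsto' hlim fun j => hj j w hw

/-- A four-norm bound extends from vectors to positive semidefinite matrices with range in the
range of `P`, here given as a sum of squares `∑ i, w i ⊗ w i`, by the triangle inequality. -/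
theorem FourNormBound.sum_sq_sum_sq_le {P : Matrix V V ℝ} {a : ℝ} (h : FourNormBound P a)
    (ha : 0 ≤ a) {ι : Type*} [Fintype ι] (w : ι → V → ℝ) (hw : ∀ i, P *ᵥ w i = w i) :
    ∑ u, (∑ i, w i u ^ 2) ^ 2 ≤ a * (∑ u, ∑ i, w i u ^ 2) ^ 2 := by
  set s : ι → ℝ := fun i => ∑ u, w i u ^ 2 with hs
  have hs0 : ∀ i, 0 ≤ s i := fun i => Finset.sum_nonneg fun u _ => sq_nonneg _
  have key : ∀ i j, ∑ u, w i u ^ 2 * w j u ^ 2 ≤ a * (s i * s j) := fun i j => by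
    refine abs_le_of_sq_le_sq' ?_ (by have := hs0 i; have := hs0 j; positivity) |>.2
    calc _ ≤ (∑ u, (w i u ^ 2) ^ 2) * ∑ u, (w j u ^ 2) ^ 2 :=
          Finset.sum_mul_sq_le_sq_mul_sq _ _ _
      _ = (∑ u, w i u ^ 4) * ∑ u, w j u ^ 4 := by
          congr 1 <;> exact Finset.sum_congr rfl fun u _ => by ring
      _ ≤ (a * s i ^ 2) * (a * s j ^ 2) :=
          mul_le_mul (h _ (hw i)) (h _ (hw j)) (Finset.sum_nonneg fun u _ => by positivity)
            (by positivity)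
      _ = _ := by ring
  calc ∑ u, (∑ i, w i u ^ 2) ^ 2 = ∑ i, ∑ j, ∑ u, w i u ^ 2 * w j u ^ 2 := by
        simp only [sq (∑ i, _), Finset.sum_mul_sum]
        rw [Finset.sum_comm]
        exact Finset.sum_congr rfl fun i _ => Finset.sum_comm
    _ ≤ ∑ i, ∑ j, a * (s i * s j) :=
        Finset.sum_le_sum fun i _ => Finset.sum_le_sum fun j _ => key i j
    _ = a * (∑ i, s i) ^ 2 := by
        rw [sq, Finset.sum_mul_sum]
        simp only [Finset.mul_sum]
    _ = _ := by
        congr 2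
        exact Finset.sum_comm

/-- The sum of the fourth powers of the entries of the projection matrix, in terms of its rank. -/
theorem FourNormBound.sum_pow_four_entries_le {P : Matrix V V ℝ} {a : ℝ}
    (h : FourNormBound P a) (ha : 0 ≤ a) (hP : ∀ u v, P u v = P v u) (hPP : P * P = P) :
    ∑ u, ∑ v, P u v ^ 4 ≤ a ^ 2 * (∑ u, P u u) ^ 2 := by
  have hrow : ∀ i, P *ᵥ P i = P i := fun i => by
    ext u
    have := congrFun (congrFun hPP u) i
    rw [Matrix.mul_apply] at this
    simp only [Matrix.mulVec, dotProduct]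
    simp_rw [hP i]
    exact this
  have hdiag : ∀ u, ∑ i, P i u ^ 2 = P u u := fun u => by
    have := congrFun (congrFun hPP u) u
    rw [Matrix.mul_apply] at this
    rw [← this]
    exact Finset.sum_congr rfl fun i _ => by rw [hP u i, sq]
  have h1 := h.sum_sq_sum_sq_le ha P hrow
  simp only [hdiag] at h1
  calc ∑ u, ∑ v, P u v ^ 4 ≤ ∑ u, a * (P u u) ^ 2 := Finset.sum_le_sum fun u _ => by
        refine (h _ (hrow u)).trans_eq ?_
        rw [← hdiag u]
        simp_rw [hP u]
    _ ≤ a * (a * (∑ u, P u u) ^ 2) := by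
        rw [← Finset.mul_sum]
        gcongr
    _ = _ := by ring

end FourNorm

section Expansion

variable {V : Type*} [Fintype V] [DecidableEq V] {G : SimpleGraph V} [DecidableRel G.Adj]

/-- Expansion in terms of the weight of the walk matrix inside the set. -/
theorem sum_sum_walkMatrix {D : ℕ} (hD : 0 < D) (hG : G.IsRegularOfDegree D) (S : Finset V) :
    ∑ u ∈ S, ∑ v ∈ S, walkMatrix G u v = S.card - expansion G S * S.card := by
  rcases S.eq_empty_or_nonempty with rfl | hne
  · simp
  have hS : (S.card : ℝ) ≠ 0 := by exact_mod_cast hne.card_ne_zero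
  have hD' : (D : ℝ) ≠ 0 := by exact_mod_cast hD.ne'
  rw [expansion, div_mul_cancel₀ _ hS, eq_sub_iff_add_eq, ← Finset.sum_add_distrib]
  rw [Finset.card_eq_sum_ones, Nat.cast_sum]
  refine Finset.sum_congr rfl fun u _ => ?_
  have h1 : ∑ v ∈ S, walkMatrix G u v = ((G.neighborFinset u ∩ S).card : ℝ) / D := by
    simp only [walkMatrix, Matrix.of_apply, hG.degree_eq]
    rw [← Finset.sum_filter, Finset.sum_const, nsmul_eq_mul, mul_one_div]
    congr 3
    ext v
    simp [and_comm]
  have h2 := Finset.card_inter_add_card_sdiff (G.neighborFinset u) S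
  rw [G.card_neighborFinset_eq_degree, hG.degree_eq] at h2
  rw [h1, hG.degree_eq, ← add_div, div_eq_iff hD']
  push_cast
  rw [one_mul]
  exact_mod_cast h2

/-- If small sets expand almost perfectly, then the top eigenspace is hypercontractive. -/
theorem fourNormBound_of_expansion [Nonempty V] {D : ℕ} (hD : 0 < D)
    (hG : G.IsRegularOfDegree D) {lam η δ : ℝ} (hη : 0 < η) (hδ : 0 < δ)
    (hsmall : 27 * (2 * η + (1 - lam) ^ 4) ≤ 1 / 2)
    (hS : ∀ S : Finset V, S.Nonempty → setMeasure S ≤ δ → 1 - η ≤ expansion G S) :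
    FourNormBound (topProjector G lam) (56 / (δ * Fintype.card V)) := by
  have hn : (0 : ℝ) < Fintype.card V := by exact_mod_cast Fintype.card_pos
  have hM : 0 < δ * Fintype.card V := by positivity
  have hθ : 0 < √(η / 2) := by positivity
  have hθ2 : √(η / 2) ^ 2 = η / 2 := Real.sq_sqrt (by positivity)
  have hW : ∀ S : Finset V, S.Nonempty → (S.card : ℝ) ≤ δ * Fintype.card V →
      ∑ u ∈ S, ∑ v ∈ S, walkMatrix G u v ≤ 2 * √(η / 2) ^ 2 * S.card := fun S hne hcard => by
    have h1 := hS S hne ((div_le_iff₀ hn).2 hcard)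
    have h2 : (0 : ℝ) ≤ S.card := by positivity
    rw [sum_sum_walkMatrix hD hG, hθ2]
    nlinarith
  have e : (56 : ℝ) / (δ * Fintype.card V) = 2 * (28 / (δ * Fintype.card V)) := by ring
  rw [e]
  refine FourNormBound.of_half (fun a ha h w hw => ?_) (by positivity)
  have h1 := sum_pow_four_le_of_small_sets walkMatrix_nonneg (walkMatrix_comm hG)
    (walkMatrix_row_sum hD hG) hθ hM hW w
  rw [hθ2] at h1
  have h2 := h w hw
  -- The error `w - W w` lies in the top eigenspace too, so its four-norm is as small as its
  -- two-norm.
  have h3 := h (fun u => w u - (walkMatrix G *ᵥ w) u) (by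
    have : (fun u => w u - (walkMatrix G *ᵥ w) u) = w - walkMatrix G *ᵥ w := rfl
    rw [this, Matrix.mulVec_sub, ← walkMatrix_mulVec_topProjector hG, hw])
  have h4 := sum_sq_sub_walkMatrix_le hD hG hw
  have h5 : (∑ u, (w u - (walkMatrix G *ᵥ w) u) ^ 2) ^ 2 ≤
      (1 - lam) ^ 4 * (∑ u, w u ^ 2) ^ 2 := by
    calc _ ≤ ((1 - lam) ^ 2 * ∑ u, w u ^ 2) ^ 2 :=
          pow_le_pow_left₀ (Finset.sum_nonneg fun u _ => sq_nonneg _) h4 2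
      _ = _ := by ring
  have h6 : 0 ≤ a * (∑ u, w u ^ 2) ^ 2 := by positivity
  have h7 := mul_le_mul_of_nonneg_right hsmall h6
  have h8 := mul_le_mul_of_nonneg_left h2 hη.le
  have h9 := mul_le_mul_of_nonneg_left h5 ha
  linarith

end Expansion

/-! ### Pseudo-expectations and their second moments -/

section Pseudo

open MvPolynomial

variable {σ : Type*} {ℓ : ℕ} {E : MvPolynomial σ ℝ →ₗ[ℝ] ℝ}

/-- The Cauchy–Schwarz inequality for pseudo-expectations. -/
theorem IsPseudoExpectation.sq_map_mul_le (hE : IsPseudoExpectation ℓ E) {P Q : MvPolynomial σ ℝ}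
    (hP : 2 * P.totalDegree ≤ ℓ) (hQ : 2 * Q.totalDegree ≤ ℓ) :
    E (P * Q) ^ 2 ≤ E (P ^ 2) * E (Q ^ 2) := by
  have h : ∀ t : ℝ, 0 ≤ E (Q ^ 2) * (t * t) + (2 * E (P * Q)) * t + E (P ^ 2) := fun t => by
    have h1 := hE.positivity (P + t • Q) (by
      have h2 := totalDegree_add P (t • Q)
      have h3 := totalDegree_smul_le t Q
      have h4 := max_le_max (le_refl P.totalDegree) h3
      have h5 := max_cases P.totalDegree Q.totalDegree
      omega)
    have h6 : (P + t • Q) ^ 2 = P ^ 2 + (2 * t) • (P * Q) + (t * t) • Q ^ 2 := by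
      simp only [smul_eq_C_mul, map_mul, map_ofNat]
      ring
    rw [h6, map_add, map_add, map_smul, map_smul, smul_eq_mul, smul_eq_mul] at h1
    linarith
  have h7 := discrim_le_zero h
  rw [discrim] at h7
  nlinarith

/-- A pseudo-expectation consistent with `P ≡ 0` vanishes on the low-degree multiples of `P`. -/
theorem IsPseudoExpectation.map_mul_eq_zero (hE : IsPseudoExpectation ℓ E)
    {P Q : MvPolynomial σ ℝ} (hP : IsConsistent ℓ E P) (hQ : 2 * Q.totalDegree ≤ ℓ) :
    E (P * Q) = 0 := by
  have h := hE.sq_map_mul_le hP.1 hQ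
  rw [hP.2, zero_mul] at h
  exact pow_eq_zero_iff two_ne_zero |>.1 (le_antisymm h (sq_nonneg _))

theorem totalDegree_mul_le_of_le {p q : MvPolynomial σ ℝ} {m n : ℕ} (hp : p.totalDegree ≤ m)
    (hq : q.totalDegree ≤ n) : (p * q).totalDegree ≤ m + n :=
  (totalDegree_mul p q).trans (add_le_add hp hq)

theorem totalDegree_sq_le_of_le {p : MvPolynomial σ ℝ} {m : ℕ} (hp : p.totalDegree ≤ m) :
    (p ^ 2).totalDegree ≤ 2 * m :=
  (totalDegree_pow p 2).trans (Nat.mul_le_mul_left 2 hp)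

theorem totalDegree_linear_le {V : Type*} [Fintype V] (x : V → ℝ) (s : V → σ) :
    (∑ v, C (x v) * X (R := ℝ) (s v)).totalDegree ≤ 1 := by
  refine totalDegree_finsetSum_le fun v _ => ?_
  exact totalDegree_mul_le_of_le (totalDegree_C _).le (totalDegree_X _).le

end Pseudo

section PosSemidef

variable {V : Type*} [Fintype V]

theorem sum_mul_mulVec_proj {P : Matrix V V ℝ} (hP : ∀ u v, P u v = P v u) (hPP : P * P = P)
    (x : V → ℝ) : ∑ u, x u * (P *ᵥ x) u = ∑ u, (P *ᵥ x) u ^ 2 := by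
  have hPt : Pᵀ = P := by
    ext u v
    exact hP v u
  have h1 : (P *ᵥ x) ⬝ᵥ (P *ᵥ x) = x ⬝ᵥ (P *ᵥ x) := by
    conv_lhs => rw [Matrix.dotProduct_mulVec, ← Matrix.mulVec_transpose, hPt,
      Matrix.mulVec_mulVec, hPP, dotProduct_comm]
  simpa [dotProduct, sq] using h1.symm

theorem sum_sq_mulVec_proj {P : Matrix V V ℝ} (hP : ∀ u v, P u v = P v u) (hPP : P * P = P)
    (x : V → ℝ) :
    ∑ u, (P *ᵥ x) u ^ 2 + ∑ u, (x u - (P *ᵥ x) u) ^ 2 = ∑ u, x u ^ 2 := by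
  have h := sum_mul_mulVec_proj hP hPP x
  have e : ∑ u, (x u - (P *ᵥ x) u) ^ 2 =
      ∑ u, x u ^ 2 - 2 * ∑ u, x u * (P *ᵥ x) u + ∑ u, (P *ᵥ x) u ^ 2 := by
    rw [Finset.mul_sum, ← Finset.sum_sub_distrib, ← Finset.sum_add_distrib]
    exact Finset.sum_congr rfl fun u _ => by ring
  linarith

/-- The second moments of a projected positive semidefinite form have a small diagonal in the
two-norm. -/
theorem FourNormBound.sum_sq_diag_le {P : Matrix V V ℝ} {a : ℝ} (h : FourNormBound P a)
    (ha : 0 ≤ a) (hP : ∀ u v, P u v = P v u) (hPP : P * P = P) {M : Matrix V V ℝ}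
    (hM : M.PosSemidef) :
    ∑ u, (∑ v, ∑ w, P u v * P u w * M v w) ^ 2 ≤ a * (∑ u, M u u) ^ 2 := by
  obtain ⟨m, x, rfl⟩ := Matrix.posSemidef_iff_eq_sum_vecMulVec.1 hM
  have e1 : ∀ u, ∑ v, ∑ w, P u v * P u w * (∑ i, vecMulVec (x i) (star (x i))) v w =
      ∑ i, (P *ᵥ x i) u ^ 2 := fun u => by
    simp only [Matrix.sum_apply, vecMulVec_apply, star_trivial, Finset.mul_sum]
    calc _ = ∑ v, ∑ i, ∑ w, P u v * P u w * (x i v * x i w) :=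
          Finset.sum_congr rfl fun v _ => Finset.sum_comm
      _ = ∑ i, ∑ v, ∑ w, P u v * P u w * (x i v * x i w) := Finset.sum_comm
      _ = _ := by
        refine Finset.sum_congr rfl fun i _ => ?_
        rw [sq, Matrix.mulVec, dotProduct, Finset.sum_mul_sum]
        exact Finset.sum_congr rfl fun v _ => Finset.sum_congr rfl fun w _ => by ring
  simp only [e1]
  refine (h.sum_sq_sum_sq_le ha (fun i => P *ᵥ x i) fun i => by
    rw [Matrix.mulVec_mulVec, hPP]).trans ?_
  refine mul_le_mul_of_nonneg_left (pow_le_pow_left₀ ?_ ?_ 2) ha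
  · exact Finset.sum_nonneg fun u _ => Finset.sum_nonneg fun i _ => sq_nonneg _
  · simp only [Matrix.sum_apply, vecMulVec_apply, star_trivial]
    rw [Finset.sum_comm, Finset.sum_comm (f := fun u i => x i u * x i u)]
    refine Finset.sum_le_sum fun i _ => ?_
    have h1 := sum_sq_mulVec_proj hP hPP (x i)
    have h2 : 0 ≤ ∑ u, (x i u - (P *ᵥ x i) u) ^ 2 := Finset.sum_nonneg fun u _ => sq_nonneg _
    simp only [← sq]
    linarith

end PosSemidef

section Refutation

open MvPolynomial

variable {V : Type*} [Fintype V] [DecidableEq V] {G : SimpleGraph V} [DecidableRel G.Adj]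
  {lam ε c : ℝ} {k : ℕ} {E : MvPolynomial (Var V) ℝ →ₗ[ℝ] ℝ}

theorem totalDegree_projF_le (lam : ℝ) (u : V) : (projF G lam u).totalDegree ≤ 1 :=
  totalDegree_linear_le _ _

theorem map_mul_sum_X_f_sq (hE : IsPseudoExpectation 16 E)
    (hsys : ∀ P ∈ system G lam ε c k, IsConsistent 16 E P) {q : MvPolynomial (Var V) ℝ}
    (hq : q.totalDegree ≤ 8) : ∑ u, E (q * X (Var.f u) ^ 2) = k * E q := by
  have h1 : ∀ u, E (q * X (Var.f u) ^ 2) = E (q * X (Var.f u)) := fun u => by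
    have := hE.map_mul_eq_zero (hsys (X (Var.f u) ^ 2 - X (Var.f u))
      (Or.inl (Or.inl (Or.inl (Or.inl (Or.inl ⟨u, rfl⟩))))))
      (Q := q) (by omega)
    rw [mul_comm, mul_sub, map_sub, sub_eq_zero] at this
    exact this
  have h2 := hE.map_mul_eq_zero (hsys (∑ u, X (Var.f u) - C (k : ℝ))
    (Or.inl (Or.inl (Or.inl (Or.inl (Or.inr rfl))))))
    (Q := q) (by omega)
  rw [mul_comm, mul_sub, map_sub, sub_eq_zero, Finset.mul_sum, map_sum, mul_comm q,
    ← smul_eq_C_mul, map_smul, smul_eq_mul] at h2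
  simp_rw [h1]
  exact h2

/-- Conditioned on any square `q ^ 2`, the second moments of the projected indicator function are
spread out. -/
theorem sum_sq_map_sq_mul_projF_le (hE : IsPseudoExpectation 16 E)
    (hsys : ∀ P ∈ system G lam ε c k, IsConsistent 16 E P) {a : ℝ} (ha : 0 ≤ a)
    (h : FourNormBound (topProjector G lam) a) {q : MvPolynomial (Var V) ℝ}
    (hq : q.totalDegree ≤ 3) :
    ∑ u, E ((projF G lam u * q) ^ 2) ^ 2 ≤ a * k ^ 2 * E (q ^ 2) ^ 2 := by
  set M : Matrix V V ℝ := Matrix.of fun u v => E (q ^ 2 * (X (Var.f u) * X (Var.f v))) with hM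
  have hpsd : M.PosSemidef := by
    refine Matrix.PosSemidef.of_dotProduct_mulVec_nonneg ?_ fun x => ?_
    · ext u v
      simp [hM, mul_comm (X (Var.f u))]
    · have h1 := hE.positivity ((∑ u, C (x u) * X (Var.f u)) * q) (by
        have := totalDegree_mul_le_of_le (totalDegree_linear_le x Var.f) hq
        omega)
      refine h1.trans_eq ?_
      rw [mul_pow, sq (∑ u, _), Finset.sum_mul_sum, Finset.sum_mul, map_sum]
      simp only [dotProduct, Matrix.mulVec, Pi.star_apply, star_trivial, Finset.mul_sum]
      refine Finset.sum_congr rfl fun u _ => ?_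
      rw [Finset.sum_mul, map_sum]
      refine Finset.sum_congr rfl fun v _ => ?_
      have : C (x u) * X (Var.f u) * (C (x v) * X (Var.f v)) * q ^ 2 =
          (x u * x v) • (q ^ 2 * (X (Var.f u) * X (Var.f v))) := by
        rw [smul_eq_C_mul, map_mul]
        ring
      rw [this, map_smul, smul_eq_mul, hM, Matrix.of_apply]
      ring
  have h1 := h.sum_sq_diag_le ha (topProjector_comm lam) (topProjector_mul_self lam) hpsd
  have h2 : ∑ u, M u u = k * E (q ^ 2) := by
    rw [← map_mul_sum_X_f_sq hE hsys ((totalDegree_sq_le_of_le hq).trans (by norm_num))]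
    simp only [hM, Matrix.of_apply, sq (X _)]
  have h3 : ∀ u, E ((projF G lam u * q) ^ 2) =
      ∑ v, ∑ w, topProjector G lam u v * topProjector G lam u w * M v w := fun u => by
    rw [projF, mul_pow, sq (∑ v, _), Finset.sum_mul_sum, Finset.sum_mul, map_sum]
    refine Finset.sum_congr rfl fun v _ => ?_
    rw [Finset.sum_mul, map_sum]
    refine Finset.sum_congr rfl fun w _ => ?_
    have : C (topProjector G lam u v) * X (Var.f v) * (C (topProjector G lam u w) * X (Var.f w))
        * q ^ 2 = (topProjector G lam u v * topProjector G lam u w) •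
          (q ^ 2 * (X (Var.f v) * X (Var.f w))) := by
      rw [smul_eq_C_mul, map_mul]
      ring
    rw [this, map_smul, smul_eq_mul, hM, Matrix.of_apply]
  simp only [h3]
  refine h1.trans_eq ?_
  rw [h2]
  ring

theorem totalDegree_prod_projF_le (lam : ℝ) {n : ℕ} (p : Fin n → V) :
    (∏ i, projF G lam (p i)).totalDegree ≤ n := by
  refine (totalDegree_finsetProd _ _).trans ?_
  calc _ ≤ ∑ _i : Fin n, 1 := Finset.sum_le_sum fun i _ => totalDegree_projF_le lam _
    _ = n := by simp

/-- The bound `sum_sq_map_sq_mul_projF_le`, iterated. -/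
theorem sum_sq_map_prod_projF_le (hE : IsPseudoExpectation 16 E)
    (hsys : ∀ P ∈ system G lam ε c k, IsConsistent 16 E P) {a : ℝ} (ha : 0 ≤ a)
    (h : FourNormBound (topProjector G lam) a) {n : ℕ} (hn : n ≤ 4) :
    ∑ p : Fin n → V, E ((∏ i, projF G lam (p i)) ^ 2) ^ 2 ≤ (a * k ^ 2) ^ n := by
  induction n with
  | zero => simp [hE.normalization]
  | succ n ih =>
    rw [← (Fin.consEquiv fun _ : Fin (n + 1) => V).sum_comp, Fintype.sum_prod_type_right]
    simp only [Fin.consEquiv_apply, Fin.prod_univ_succ, Fin.cons_zero, Fin.cons_succ]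
    calc _ ≤ ∑ p : Fin n → V, a * k ^ 2 * E ((∏ i, projF G lam (p i)) ^ 2) ^ 2 :=
          Finset.sum_le_sum fun p _ => sum_sq_map_sq_mul_projF_le hE hsys ha h
            ((totalDegree_prod_projF_le lam p).trans (by omega))
      _ ≤ a * k ^ 2 * (a * k ^ 2) ^ n := by
          rw [← Finset.mul_sum]
          exact mul_le_mul_of_nonneg_left (ih (by omega)) (by positivity)
      _ = _ := by ring

end Refutation

/-! ### Refutation of the relaxation -/

section Refutation

open MvPolynomial

variable {V : Type*} [Fintype V] [DecidableEq V] {G : SimpleGraph V} [DecidableRel G.Adj]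
  {lam ε c : ℝ} {k : ℕ} {E : MvPolynomial (Var V) ℝ →ₗ[ℝ] ℝ}

/-- One of the two polynomials `(Π f) u ^ 2 ± c g u`, which the system requires to be
nonnegative. -/
noncomputable def sandwich (G : SimpleGraph V) [DecidableRel G.Adj] (lam c : ℝ) (b : Bool) (u : V) :
    MvPolynomial (Var V) ℝ :=
  if b then projF G lam u ^ 2 + C c * X (Var.g u) else projF G lam u ^ 2 - C c * X (Var.g u)

/-- The slack variable of the inequality `0 ≤ sandwich G lam c b u`. -/
def slack (b : Bool) (u : V) : Var V := if b then Var.slackUpper u else Var.slackLower u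

theorem totalDegree_sandwich_le (lam c : ℝ) (b : Bool) (u : V) :
    (sandwich G lam c b u).totalDegree ≤ 2 := by
  have h1 := totalDegree_sq_le_of_le (totalDegree_projF_le (G := G) lam u)
  have h2 : (C c * X (R := ℝ) (Var.g u)).totalDegree ≤ 0 + 1 :=
    totalDegree_mul_le_of_le (totalDegree_C _).le (totalDegree_X _).le
  unfold sandwich
  split_ifs
  · exact (totalDegree_add _ _).trans (max_le (by omega) (by omega))
  · exact (totalDegree_sub _ _).trans (max_le (by omega) (by omega))

theorem map_sandwich_mul (hE : IsPseudoExpectation 16 E)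
    (hsys : ∀ P ∈ system G lam ε c k, IsConsistent 16 E P) (b : Bool) (u : V)
    {q : MvPolynomial (Var V) ℝ} (hq : q.totalDegree ≤ 8) :
    E (sandwich G lam c b u * q) = E (X (slack b u) ^ 2 * q) := by
  have hmem : sandwich G lam c b u - X (slack b u) ^ 2 ∈ system G lam ε c k := by
    cases b
    · exact Or.inl (Or.inl (Or.inr ⟨u, by simp [sandwich, slack]⟩))
    · exact Or.inl (Or.inr ⟨u, by simp [sandwich, slack]⟩)
  have := hE.map_mul_eq_zero (hsys _ hmem) (Q := q) (by omega)
  rwa [sub_mul, map_sub, sub_eq_zero] at this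

theorem map_sandwich_nonneg (hE : IsPseudoExpectation 16 E)
    (hsys : ∀ P ∈ system G lam ε c k, IsConsistent 16 E P) (b₁ b₂ b₃ b₄ : Bool)
    (u₁ u₂ u₃ u₄ : V) :
    0 ≤ E (sandwich G lam c b₁ u₁ * (sandwich G lam c b₂ u₂ * (sandwich G lam c b₃ u₃ *
      sandwich G lam c b₄ u₄))) := by
  have hs := totalDegree_sandwich_le (G := G) lam c
  have hx : ∀ b u, (X (R := ℝ) (slack (V := V) b u) ^ 2).totalDegree ≤ 2 := fun b u =>
    totalDegree_sq_le_of_le (totalDegree_X _).le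
  have d34 := totalDegree_mul_le_of_le (hs b₃ u₃) (hs b₄ u₄)
  have d1 := totalDegree_mul_le_of_le (hs b₂ u₂) d34
  have d2 := totalDegree_mul_le_of_le d34 (hx b₁ u₁)
  have d3 := totalDegree_mul_le_of_le (hs b₄ u₄)
    (totalDegree_mul_le_of_le (hx b₁ u₁) (hx b₂ u₂))
  have d4 := totalDegree_mul_le_of_le (hx b₁ u₁)
    (totalDegree_mul_le_of_le (hx b₂ u₂) (hx b₃ u₃))
  have dx := totalDegree_mul_le_of_le (totalDegree_mul_le_of_le
    (totalDegree_X (R := ℝ) (slack b₁ u₁)).le (totalDegree_X (R := ℝ) (slack b₂ u₂)).le)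
    (totalDegree_mul_le_of_le
    (totalDegree_X (R := ℝ) (slack b₃ u₃)).le (totalDegree_X (R := ℝ) (slack b₄ u₄)).le)
  -- The four factors are replaced by the squares of their slack variables one at a time.
  rw [map_sandwich_mul hE hsys b₁ u₁ (d1.trans (by norm_num)), mul_left_comm,
    mul_comm (X (slack b₁ u₁) ^ 2),
    map_sandwich_mul hE hsys b₂ u₂ (d2.trans (by norm_num))]
  rw [show X (slack b₂ u₂) ^ 2 * (sandwich G lam c b₃ u₃ * sandwich G lam c b₄ u₄ *
      X (slack b₁ u₁) ^ 2) = sandwich G lam c b₃ u₃ * (sandwich G lam c b₄ u₄ *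
      (X (slack b₁ u₁) ^ 2 * X (slack b₂ u₂) ^ 2)) by ring,
    map_sandwich_mul hE hsys b₃ u₃ (d3.trans (by norm_num))]
  rw [show X (slack b₃ u₃) ^ 2 * (sandwich G lam c b₄ u₄ *
      (X (slack b₁ u₁) ^ 2 * X (slack b₂ u₂) ^ 2)) = sandwich G lam c b₄ u₄ *
      (X (slack b₁ u₁) ^ 2 * (X (slack b₂ u₂) ^ 2 * X (slack b₃ u₃) ^ 2)) by ring,
    map_sandwich_mul hE hsys b₄ u₄ (d4.trans (by norm_num))]
  refine (hE.positivity _ (Nat.mul_le_mul_left 2 dx |>.trans (by norm_num))).trans_eq ?_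
  congr 1
  ring

/-- The mixed fourth moments of `g` are dominated by the moments of `(Π f) ^ 2`. -/
theorem abs_map_prod_g_le (hE : IsPseudoExpectation 16 E)
    (hsys : ∀ P ∈ system G lam ε c k, IsConsistent 16 E P) (p : Fin 4 → V) :
    |c ^ 4 * E (∏ i, X (Var.g (p i)))| ≤ E ((∏ i, projF G lam (p i)) ^ 2) := by
  have h := map_sandwich_nonneg hE hsys
  have hC : c ^ 4 * E (∏ i, X (Var.g (p i))) =
      E (∏ i, (C c * X (Var.g (p i)))) := by
    rw [Finset.prod_mul_distrib, Finset.prod_const, Finset.card_univ, Fintype.card_fin,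
      ← map_pow, ← smul_eq_C_mul, map_smul, smul_eq_mul]
  rw [hC, ← Finset.prod_pow]
  simp only [Fin.prod_univ_four]
  -- The products with an even number of minus signs add up to `8 (∏ Fᵢ² + ∏ c gᵢ)`, those with an
  -- odd number to `8 (∏ Fᵢ² - ∏ c gᵢ)`.
  have hpos : ∀ A B : MvPolynomial (Var V) ℝ, (8 : ℝ) • (A + B) = 8 * A + 8 * B := fun A B => by
    rw [smul_eq_C_mul, map_ofNat]
    ring
  have hneg : ∀ A B : MvPolynomial (Var V) ℝ, (8 : ℝ) • (A - B) = 8 * A - 8 * B := fun A B => by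
    rw [smul_eq_C_mul, map_ofNat]
    ring
  rw [abs_le]
  constructor
  · have e := hpos (projF G lam (p 0) ^ 2 * projF G lam (p 1) ^ 2 * projF G lam (p 2) ^ 2 *
      projF G lam (p 3) ^ 2) (C c * X (Var.g (p 0)) * (C c * X (Var.g (p 1))) *
      (C c * X (Var.g (p 2))) * (C c * X (Var.g (p 3))))
    have e' : (8 : MvPolynomial (Var V) ℝ) * (projF G lam (p 0) ^ 2 * projF G lam (p 1) ^ 2 *
      projF G lam (p 2) ^ 2 * projF G lam (p 3) ^ 2) + 8 * (C c * X (Var.g (p 0)) *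
      (C c * X (Var.g (p 1))) * (C c * X (Var.g (p 2))) * (C c * X (Var.g (p 3)))) =
      ∑ b₁ : Bool, ∑ b₂ : Bool, ∑ b₃ : Bool, sandwich G lam c b₁ (p 0) *
        (sandwich G lam c b₂ (p 1) * (sandwich G lam c b₃ (p 2) *
          sandwich G lam c (b₁ ^^ b₂ ^^ b₃) (p 3))) := by
      simp [sandwich]
      ring
    have h1 := congrArg E (e.trans e')
    simp only [map_smul, map_sum, map_add, smul_eq_mul] at h1
    have h2 : 0 ≤ ∑ b₁ : Bool, ∑ b₂ : Bool, ∑ b₃ : Bool, E (sandwich G lam c b₁ (p 0) *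
        (sandwich G lam c b₂ (p 1) * (sandwich G lam c b₃ (p 2) *
          sandwich G lam c (b₁ ^^ b₂ ^^ b₃) (p 3)))) :=
      Finset.sum_nonneg fun b₁ _ => Finset.sum_nonneg fun b₂ _ => Finset.sum_nonneg fun b₃ _ =>
        h _ _ _ _ _ _ _ _
    linarith
  · have e := hneg (projF G lam (p 0) ^ 2 * projF G lam (p 1) ^ 2 * projF G lam (p 2) ^ 2 *
      projF G lam (p 3) ^ 2) (C c * X (Var.g (p 0)) * (C c * X (Var.g (p 1))) *
      (C c * X (Var.g (p 2))) * (C c * X (Var.g (p 3))))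
    have e' : (8 : MvPolynomial (Var V) ℝ) * (projF G lam (p 0) ^ 2 * projF G lam (p 1) ^ 2 *
      projF G lam (p 2) ^ 2 * projF G lam (p 3) ^ 2) - 8 * (C c * X (Var.g (p 0)) *
      (C c * X (Var.g (p 1))) * (C c * X (Var.g (p 2))) * (C c * X (Var.g (p 3)))) =
      ∑ b₁ : Bool, ∑ b₂ : Bool, ∑ b₃ : Bool, sandwich G lam c b₁ (p 0) *
        (sandwich G lam c b₂ (p 1) * (sandwich G lam c b₃ (p 2) *
          sandwich G lam c (!(b₁ ^^ b₂ ^^ b₃)) (p 3))) := by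
      simp [sandwich]
      ring
    have h1 := congrArg E (e.trans e')
    simp only [map_smul, map_sum, map_sub, smul_eq_mul] at h1
    have h2 : 0 ≤ ∑ b₁ : Bool, ∑ b₂ : Bool, ∑ b₃ : Bool, E (sandwich G lam c b₁ (p 0) *
        (sandwich G lam c b₂ (p 1) * (sandwich G lam c b₃ (p 2) *
          sandwich G lam c (!(b₁ ^^ b₂ ^^ b₃)) (p 3)))) :=
      Finset.sum_nonneg fun b₁ _ => Finset.sum_nonneg fun b₂ _ => Finset.sum_nonneg fun b₃ _ =>
        h _ _ _ _ _ _ _ _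
    linarith

/-- The fourth moment of a projected random vector `g` is the pairing of the fourth moment tensor
of `g` with the tensor `∑ u, (P u)^{⊗ 4}`, whose norm is given by `P` alone. -/
theorem sq_map_sum_projG_pow_le (E : MvPolynomial (Var V) ℝ →ₗ[ℝ] ℝ) (lam : ℝ) :
    E (∑ u, projG G lam u ^ 4) ^ 2 ≤ (∑ u, ∑ v, topProjector G lam u v ^ 4) *
      ∑ p : Fin 4 → V, E (∏ i, X (Var.g (p i))) ^ 2 := by
  have e1 : E (∑ u, projG G lam u ^ 4) = ∑ p : Fin 4 → V,
      (∑ u, ∏ i, topProjector G lam u (p i)) * E (∏ i, X (Var.g (p i))) := by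
    simp only [projG, Fintype.sum_pow, map_sum, Finset.sum_mul]
    rw [Finset.sum_comm]
    refine Finset.sum_congr rfl fun p _ => Finset.sum_congr rfl fun u _ => ?_
    rw [Finset.prod_mul_distrib, ← map_prod, ← smul_eq_C_mul, map_smul, smul_eq_mul]
  have e2 : ∑ p : Fin 4 → V, (∑ u, ∏ i, topProjector G lam u (p i)) ^ 2 =
      ∑ u, ∑ v, topProjector G lam u v ^ 4 := by
    simp only [sq (∑ u, _), Finset.sum_mul_sum]
    rw [Finset.sum_comm]
    refine Finset.sum_congr rfl fun u _ => ?_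
    rw [Finset.sum_comm]
    refine Finset.sum_congr rfl fun v _ => ?_
    have h := congrFun (congrFun (topProjector_mul_self (G := G) lam) u) v
    rw [Matrix.mul_apply] at h
    rw [← h, Fintype.sum_pow]
    refine Finset.sum_congr rfl fun p _ => ?_
    rw [← Finset.prod_mul_distrib]
    exact Finset.prod_congr rfl fun i _ => by rw [topProjector_comm lam v]
  rw [e1, ← e2]
  exact Finset.sum_mul_sq_le_sq_mul_sq _ _ _

/-- Hypercontractivity of the top eigenspace refutes the relaxation for small `k`. -/
theorem pow_five_le_of_feasible [Nonempty V] (hc : 0 < c) (hk : 1 ≤ k)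
    (hsos : SOSFeasible 16 (system G lam ε c k)) {a : ℝ} (ha : 0 ≤ a)
    (h : FourNormBound (topProjector G lam) a) :
    c ^ 5 ≤ (a * k) ^ 3 * Module.finrank ℝ (topEigenspace G lam) := by
  obtain ⟨E, hE, hsys⟩ := hsos
  have hn : (0 : ℝ) < Fintype.card V := by exact_mod_cast Fintype.card_pos
  have hk0 : (0 : ℝ) < k := by exact_mod_cast hk
  set d : ℝ := (Module.finrank ℝ (topEigenspace G lam) : ℝ) with hd
  have h1 : c * k ≤ E (∑ u, projG G lam u ^ 4) := by
    have h2 := hE.map_mul_eq_zero (hsys (C (1 / (Fintype.card V : ℝ)) * ∑ u, projG G lam u ^ 4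
      - C (c * ((k : ℝ) / (Fintype.card V : ℝ))) - X Var.slackNorm ^ 2) (Or.inr rfl))
      (Q := 1) (by simp)
    have h3 := hE.positivity (X Var.slackNorm) (by rw [totalDegree_X]; norm_num)
    have h4 : E (C (c * ((k : ℝ) / (Fintype.card V : ℝ)))) =
        c * ((k : ℝ) / (Fintype.card V : ℝ)) := by
      rw [← mul_one (C _), ← smul_eq_C_mul, map_smul, hE.normalization, smul_eq_mul, mul_one]
    rw [mul_one, map_sub, map_sub, h4, ← smul_eq_C_mul, map_smul, smul_eq_mul] at h2
    have h5 : c * ((k : ℝ) / (Fintype.card V : ℝ)) ≤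
        1 / (Fintype.card V : ℝ) * E (∑ u, projG G lam u ^ 4) := by linarith
    rw [← mul_div_assoc, one_div_mul_eq_div] at h5
    exact (div_le_div_iff_of_pos_right hn).1 h5
  have h2 := sq_map_sum_projG_pow_le (G := G) E lam
  have h3 := h.sum_pow_four_entries_le ha (topProjector_comm lam) (topProjector_mul_self lam)
  rw [trace_topProjector, ← hd] at h3
  have h4 := sum_sq_map_prod_projF_le hE hsys ha h le_rfl
  have h5 : c ^ 8 * ∑ p : Fin 4 → V, E (∏ i, X (Var.g (p i))) ^ 2 ≤ (a * k ^ 2) ^ 4 := by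
    refine le_trans ?_ h4
    rw [Finset.mul_sum]
    refine Finset.sum_le_sum fun p _ => ?_
    have := pow_le_pow_left₀ (abs_nonneg _) (abs_map_prod_g_le hE hsys p) 2
    rw [sq_abs] at this
    linarith
  have h6 : (c * k) ^ 2 ≤ E (∑ u, projG G lam u ^ 4) ^ 2 :=
    pow_le_pow_left₀ (by positivity) h1 2
  have hd0 : 0 ≤ d := by positivity
  have h7 : (c ^ 5 * k) ^ 2 ≤ ((a * k) ^ 3 * d * k) ^ 2 := by
    calc (c ^ 5 * k) ^ 2 = c ^ 8 * (c * k) ^ 2 := by ring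
      _ ≤ c ^ 8 * ((∑ u, ∑ v, topProjector G lam u v ^ 4) *
          ∑ p : Fin 4 → V, E (∏ i, X (Var.g (p i))) ^ 2) := by
        gcongr
        exact h6.trans h2
      _ = (∑ u, ∑ v, topProjector G lam u v ^ 4) *
          (c ^ 8 * ∑ p : Fin 4 → V, E (∏ i, X (Var.g (p i))) ^ 2) := by ring
      _ ≤ (a ^ 2 * d ^ 2) * (a * k ^ 2) ^ 4 :=
        mul_le_mul h3 h5 (mul_nonneg (by positivity) (Finset.sum_nonneg fun _ _ => sq_nonneg _))
          (by positivity)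
      _ = _ := by ring
  have h8 := abs_le_of_sq_le_sq' h7 (by positivity) |>.2
  exact le_of_mul_le_mul_right h8 hk0

end Refutation

/-! ### Solutions from sets of small expansion -/

section Completeness

open MvPolynomial

/-- An actual solution of a system of low degree gives a pseudo-expectation: evaluation. -/
theorem sosFeasible_of_aeval {σ : Type*} {ℓ : ℕ} {sys : Set (MvPolynomial σ ℝ)} (x : σ → ℝ)
    (hdeg : ∀ P ∈ sys, 2 * P.totalDegree ≤ ℓ) (hx : ∀ P ∈ sys, aeval x P = 0) :
    SOSFeasible ℓ sys := by
  refine ⟨(aeval x).toLinearMap, ⟨by simp, fun P _ => ?_⟩, fun P hP => ⟨hdeg P hP, ?_⟩⟩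
  · simp only [AlgHom.toLinearMap_apply, map_pow]
    exact sq_nonneg _
  · rw [AlgHom.toLinearMap_apply, map_pow, hx P hP, zero_pow two_ne_zero]

variable {V : Type*} [Fintype V] [DecidableEq V] {G : SimpleGraph V} [DecidableRel G.Adj]

theorem totalDegree_le_of_mem_system {lam ε c : ℝ} {k : ℕ} {P : MvPolynomial (Var V) ℝ}
    (hP : P ∈ system G lam ε c k) : P.totalDegree ≤ 4 := by
  have hX : ∀ i : Var V, (X (R := ℝ) i).totalDegree ≤ 1 := fun i => (totalDegree_X i).le
  have hC : ∀ a : ℝ, (C (σ := Var V) a).totalDegree ≤ 0 := fun a => (totalDegree_C a).le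
  have hX2 : ∀ i : Var V, (X (R := ℝ) i ^ 2).totalDegree ≤ 2 := fun i =>
    totalDegree_sq_le_of_le (hX i)
  have hF : ∀ u, (projF G lam u ^ 2).totalDegree ≤ 2 := fun u =>
    totalDegree_sq_le_of_le (totalDegree_projF_le lam u)
  have hcg : ∀ u : V, (C c * X (R := ℝ) (Var.g u)).totalDegree ≤ 0 + 1 := fun u =>
    totalDegree_mul_le_of_le (hC c) (hX _)
  have hsub : ∀ {p q : MvPolynomial (Var V) ℝ}, p.totalDegree ≤ 4 → q.totalDegree ≤ 4 →
      (p - q).totalDegree ≤ 4 := fun hp hq => (totalDegree_sub _ _).trans (max_le hp hq)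
  have hadd : ∀ {p q : MvPolynomial (Var V) ℝ}, p.totalDegree ≤ 4 → q.totalDegree ≤ 4 →
      (p + q).totalDegree ≤ 4 := fun hp hq => (totalDegree_add _ _).trans (max_le hp hq)
  rcases hP with ((((⟨u, rfl⟩ | rfl) | rfl) | ⟨u, rfl⟩) | ⟨u, rfl⟩) | rfl
  · exact hsub ((hX2 _).trans (by norm_num)) ((hX _).trans (by norm_num))
  · exact hsub (totalDegree_finsetSum_le fun u _ => (hX _).trans (by norm_num))
      ((hC _).trans (by norm_num))
  · refine hsub (hsub ((hC _).trans (by norm_num)) ?_) ((hX2 _).trans (by norm_num))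
    refine totalDegree_finsetSum_le fun u _ => totalDegree_finsetSum_le fun v _ => ?_
    have h1 : (1 - X (R := ℝ) (Var.f v)).totalDegree ≤ 1 :=
      (totalDegree_sub _ _).trans (max_le (by simp) (hX _))
    exact (totalDegree_mul_le_of_le (hC _) (totalDegree_mul_le_of_le (hX _) h1)).trans
      (by norm_num)
  · exact hsub (hsub ((hF u).trans (by norm_num)) ((hcg u).trans (by norm_num)))
      ((hX2 _).trans (by norm_num))
  · exact hsub (hadd ((hF u).trans (by norm_num)) ((hcg u).trans (by norm_num)))
      ((hX2 _).trans (by norm_num))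
  · refine hsub (hsub ?_ ((hC _).trans (by norm_num))) ((hX2 _).trans (by norm_num))
    refine (totalDegree_mul_le_of_le (hC _) (totalDegree_finsetSum_le fun u _ => ?_)).trans
      (zero_add 4).le
    exact (totalDegree_pow _ 4).trans (Nat.mul_le_mul_left 4 (totalDegree_linear_le _ _))

/-- Real vectors that satisfy the inequalities of the system make its relaxation feasible. -/
theorem sosFeasible_system {lam ε c : ℝ} {k : ℕ} (f g : V → ℝ) (hf : ∀ u, f u ^ 2 = f u)
    (hk : ∑ u, f u = k)
    (hexp : ∑ u, ∑ v, walkMatrix G u v * (f u * (1 - f v)) ≤ ε * k)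
    (hlow : ∀ u, c * g u ≤ (topProjector G lam *ᵥ f) u ^ 2)
    (hupp : ∀ u, -(c * g u) ≤ (topProjector G lam *ᵥ f) u ^ 2)
    (hnorm : c * ((k : ℝ) / (Fintype.card V : ℝ)) ≤
      1 / (Fintype.card V : ℝ) * ∑ u, (topProjector G lam *ᵥ g) u ^ 4) :
    SOSFeasible 16 (system G lam ε c k) := by
  set x : Var V → ℝ := fun i => match i with
    | .f v => f v
    | .g v => g v
    | .slackLower v => √((topProjector G lam *ᵥ f) v ^ 2 - c * g v)
    | .slackUpper v => √((topProjector G lam *ᵥ f) v ^ 2 + c * g v)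
    | .slackNorm => √(1 / (Fintype.card V : ℝ) * ∑ u, (topProjector G lam *ᵥ g) u ^ 4 -
        c * ((k : ℝ) / (Fintype.card V : ℝ)))
    | .slackExpansion => √(ε * k - ∑ u, ∑ v, walkMatrix G u v * (f u * (1 - f v))) with hx
  have hF : ∀ u, aeval x (projF G lam u) = (topProjector G lam *ᵥ f) u := fun u => by
    simp [projF, hx, Matrix.mulVec, dotProduct]
  have hG : ∀ u, aeval x (projG G lam u) = (topProjector G lam *ᵥ g) u := fun u => by
    simp [projG, hx, Matrix.mulVec, dotProduct]
  refine sosFeasible_of_aeval x (fun P hP => ?_) fun P hP => ?_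
  · have := totalDegree_le_of_mem_system hP
    omega
  rcases hP with ((((⟨u, rfl⟩ | rfl) | rfl) | ⟨u, rfl⟩) | ⟨u, rfl⟩) | rfl
  · simp [hx, hf u]
  · simp [hx, hk]
  · simp only [map_sub, map_pow, map_sum, map_mul, aeval_X, aeval_C, map_one,
      Algebra.algebraMap_self, RingHom.id_apply, hx]
    rw [Real.sq_sqrt (sub_nonneg.2 hexp)]
    ring
  · simp only [map_sub, map_pow, map_mul, aeval_X, aeval_C, hF,
      Algebra.algebraMap_self, RingHom.id_apply]
    simp only [hx]
    rw [Real.sq_sqrt (sub_nonneg.2 (hlow u))]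
    ring
  · simp only [map_sub, map_add, map_pow, map_mul, aeval_X, aeval_C, hF,
      Algebra.algebraMap_self, RingHom.id_apply]
    simp only [hx]
    rw [Real.sq_sqrt (by linarith [hupp u])]
    ring
  · simp only [map_sub, map_pow, map_mul, map_sum, aeval_X, aeval_C, hG,
      Algebra.algebraMap_self, RingHom.id_apply]
    simp only [hx]
    rw [Real.sq_sqrt (sub_nonneg.2 hnorm)]
    ring

/-- If the indicator function of `S` is close to its projection, then restricting it to the points
where the projection is at least `1 / 2` in absolute value changes it little, and the projection
of the restriction still has a large four-norm. -/
theorem sum_pow_four_mulVec_indicator_ge {P : Matrix V V ℝ} (hP : ∀ u v, P u v = P v u)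
    (hPP : P * P = P) (S : Finset V) (f g : V → ℝ) (hf : f = fun u => if u ∈ S then 1 else 0)
    (hg : g = fun u => if u ∈ S ∧ 1 / 4 ≤ (P *ᵥ f) u ^ 2 then 1 else 0)
    (hclose : 100 * ∑ u, (f u - (P *ᵥ f) u) ^ 2 ≤ S.card) :
    1 / 32 * (S.card : ℝ) ≤ ∑ u, (P *ᵥ g) u ^ 4 := by
  have hg01 : ∀ u, g u = 0 ∨ g u = 1 := fun u => by
    rw [hg]
    dsimp only
    split_ifs <;> simp
  have hcard : ∑ u, f u = S.card := by simp [hf]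
  have hfg : ∀ u, (f u - g u) ^ 2 ≤ 4 * (f u - (P *ᵥ f) u) ^ 2 ∧
      f u - g u ≤ 4 * (f u - (P *ᵥ f) u) ^ 2 := fun u => by
    by_cases hu : u ∈ S
    · have hfu : f u = 1 := by simp [hf, hu]
      by_cases hF : 1 / 4 ≤ (P *ᵥ f) u ^ 2
      · have hgu : g u = 1 := by rw [hg]; exact if_pos ⟨hu, hF⟩
        rw [hfu, hgu]
        constructor <;> nlinarith [sq_nonneg (1 - (P *ᵥ f) u)]
      · have hgu : g u = 0 := by rw [hg]; exact if_neg fun h => hF h.2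
        rw [hfu, hgu]
        push Not at hF
        have h1 : (P *ᵥ f) u ≤ 1 / 2 := by nlinarith
        constructor <;> nlinarith
    · have hfu : f u = 0 := by simp [hf, hu]
      have hgu : g u = 0 := by rw [hg]; exact if_neg fun h => hu h.1
      rw [hfu, hgu]
      constructor <;> nlinarith [sq_nonneg (0 - (P *ᵥ f) u)]
  set δ := ∑ u, (f u - (P *ᵥ f) u) ^ 2 with hδ
  have h1 : ∑ u, (f - g) u ^ 2 ≤ 4 * δ := by
    rw [hδ, Finset.mul_sum]
    exact Finset.sum_le_sum fun u _ => (hfg u).1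
  have h2 : S.card - ∑ u, g u ≤ 4 * δ := by
    rw [hδ, Finset.mul_sum, ← hcard, ← Finset.sum_sub_distrib]
    exact Finset.sum_le_sum fun u _ => (hfg u).2
  have h3 : ∑ u, (g u - (P *ᵥ g) u) ^ 2 ≤ 10 * δ := by
    have h4 := sum_sq_mulVec_proj hP hPP (f - g)
    have h5 : 0 ≤ ∑ u, (P *ᵥ (f - g)) u ^ 2 := Finset.sum_nonneg fun u _ => sq_nonneg _
    have h6 : ∑ u, (g u - (P *ᵥ g) u) ^ 2 ≤ ∑ u, (2 * (f u - (P *ᵥ f) u) ^ 2 +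
        2 * ((f - g) u - (P *ᵥ (f - g)) u) ^ 2) := by
      refine Finset.sum_le_sum fun u _ => ?_
      rw [Matrix.mulVec_sub, Pi.sub_apply, Pi.sub_apply]
      nlinarith [sq_nonneg ((f u - (P *ᵥ f) u) + ((f u - g u) - ((P *ᵥ f) u - (P *ᵥ g) u)))]
    rw [Finset.sum_add_distrib, ← Finset.mul_sum, ← Finset.mul_sum, ← hδ] at h6
    linarith
  have h4 : ∑ u, g u * (P *ᵥ g) u = ∑ u, g u - ∑ u, (g u - (P *ᵥ g) u) ^ 2 := by
    have h5 := sum_sq_mulVec_proj hP hPP g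
    have h6 : ∑ u, g u ^ 2 = ∑ u, g u := Finset.sum_congr rfl fun u _ => by
      rcases hg01 u with h | h <;> simp [h]
    have h7 := sum_mul_mulVec_proj hP hPP g
    linarith
  -- On the support of `g` the fourth power is bounded below by its tangent line at `1 / 2`.
  have h5 : ∑ u, (1 / 2 * (g u * (P *ᵥ g) u) - 3 / 16 * g u) ≤ ∑ u, (P *ᵥ g) u ^ 4 := by
    refine Finset.sum_le_sum fun u _ => ?_
    rcases hg01 u with h | h
    · rw [h]
      have : 0 ≤ (P *ᵥ g) u ^ 4 := by positivity
      linarith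
    · rw [h]
      nlinarith [sq_nonneg ((P *ᵥ g) u ^ 2 - 1 / 4), sq_nonneg ((P *ᵥ g) u - 1 / 2)]
  rw [Finset.sum_sub_distrib, ← Finset.mul_sum, ← Finset.mul_sum] at h5
  linarith

/-- The indicator function of a set of small expansion solves the system. -/
theorem sosFeasible_of_expansion_le [Nonempty V] {D : ℕ} (hD : 0 < D)
    (hG : G.IsRegularOfDegree D) {C ε : ℝ} (hC : 100 ≤ C) (hε : 0 < ε) (S : Finset V)
    (hS : expansion G S ≤ ε) :
    SOSFeasible 16 (system G (1 - C * ε) ε (1 / 32) S.card) := by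
  have hn : (0 : ℝ) < Fintype.card V := by exact_mod_cast Fintype.card_pos
  have hS0 : (0 : ℝ) ≤ S.card := by positivity
  set P := topProjector G (1 - C * ε) with hPdef
  set f : V → ℝ := fun u => if u ∈ S then 1 else 0 with hf
  set g : V → ℝ := fun u => if u ∈ S ∧ 1 / 4 ≤ (P *ᵥ f) u ^ 2 then 1 else 0 with hg
  have hf2 : ∀ u, f u ^ 2 = f u := fun u => by
    simp only [hf]
    split_ifs <;> simp
  have hcard : ∑ u, f u = S.card := by simp [hf]
  have hcut : ∑ u, f u * (walkMatrix G *ᵥ f) u = S.card - expansion G S * S.card := by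
    rw [← sum_sum_walkMatrix hD hG]
    simp [hf, Matrix.mulVec, dotProduct]
  have hclose : 100 * ∑ u, (f u - (P *ᵥ f) u) ^ 2 ≤ S.card := by
    have h1 := sum_walkMatrix_mul_le_sub hD hG (1 - C * ε) f
    rw [hcut, Finset.sum_congr rfl fun u _ => hf2 u, hcard, ← hPdef] at h1
    have h2 : 0 ≤ ∑ u, (f u - (P *ᵥ f) u) ^ 2 := Finset.sum_nonneg fun u _ => sq_nonneg _
    have h3 := mul_le_mul_of_nonneg_right hS hS0
    have h4 : ε * (C * ∑ u, (f u - (P *ᵥ f) u) ^ 2) ≤ ε * S.card := by linarith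
    exact (mul_le_mul_of_nonneg_right hC h2).trans (le_of_mul_le_mul_left h4 hε)
  have hg01 : ∀ u, 0 ≤ g u := fun u => by
    simp only [hg]
    split_ifs <;> simp
  refine sosFeasible_system f g hf2 hcard ?_ (fun u => ?_) (fun u => ?_) ?_
  · have h1 : ∑ u, ∑ v, walkMatrix G u v * (f u * (1 - f v)) = expansion G S * S.card := by
      have h2 : ∀ u, ∑ v, walkMatrix G u v * (f u * (1 - f v)) =
          f u - f u * (walkMatrix G *ᵥ f) u := fun u => by
        calc _ = f u * ∑ v, walkMatrix G u v - f u * ∑ v, walkMatrix G u v * f v := by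
              rw [Finset.mul_sum, Finset.mul_sum, ← Finset.sum_sub_distrib]
              exact Finset.sum_congr rfl fun v _ => by ring
          _ = _ := by
              rw [walkMatrix_row_sum hD hG, mul_one, Matrix.mulVec, dotProduct]
      simp only [h2, Finset.sum_sub_distrib, hcut, hcard]
      ring
    rw [h1]
    gcongr
  · rw [← hPdef]
    simp only [hg]
    split_ifs with h
    · linarith [h.2]
    · rw [mul_zero]
      exact sq_nonneg _
  · have := hg01 u
    have h2 := sq_nonneg ((P *ᵥ f) u)
    rw [← hPdef]
    linarith
  · have h1 := sum_pow_four_mulVec_indicator_ge (topProjector_comm (1 - C * ε))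
      (topProjector_mul_self (1 - C * ε)) S f g hf hg hclose
    rw [← hPdef, ← mul_div_assoc, one_div_mul_eq_div (Fintype.card V : ℝ)]
    gcongr

end Completeness

end SSE

theorem mainTheorem8 :
    ∃ C : ℝ, 1 ≤ C ∧ ∃ (ℓ : ℕ) (c μ₀ ε₀ : ℝ), 0 < c ∧ 0 < μ₀ ∧ 0 < ε₀ ∧
      ∀ μ ε : ℝ, 0 < μ → μ < μ₀ → 0 < ε → ε < ε₀ →
      ∀ (V : Type*) [Fintype V] [DecidableEq V] [Nonempty V]
        (G : SimpleGraph V) [DecidableRel G.Adj] (D : ℕ),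
        0 < D → G.IsRegularOfDegree D →
        ((∃ S : Finset V, S.Nonempty ∧
            SSE.setMeasure S ≤ μ / SSE.dimFactor G (1 - C * ε) ∧ SSE.expansion G S ≤ ε) →
          SSE.SOSAccepts G ℓ (1 - C * ε) ε c μ) ∧
        ((∀ S : Finset V, S.Nonempty →
            SSE.setMeasure S ≤ C * √μ → 1 - 1 / C ≤ SSE.expansion G S) →
          ¬ SSE.SOSAccepts G ℓ (1 - C * ε) ε c μ) := by
  -- `28672 = 56 * 2 ^ 9`: with the constant `56 / (C √μ n)` in the four-norm bound, soundness comes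
  -- down to `(1 / 32) ^ 5 ≤ (1 / 2 ^ 9) ^ 3` being false. The choice of `ε₀` keeps `lam ≥ 3 / 4`, so
  -- that the walk is close to the identity on the top eigenspace.
  refine ⟨28672, by norm_num, 16, 1 / 32, 1, 1 / (4 * 28672), by norm_num, by norm_num,
    by norm_num, fun μ ε hμ hμ₁ hε hε₁ V _ _ _ G _ D hD hG => ⟨?_, ?_⟩⟩
  · rintro ⟨S, hne, hmeas, hexp⟩
    exact ⟨S.card, hne.card_pos, hmeas,
      SSE.sosFeasible_of_expansion_le hD hG (by norm_num) hε S hexp⟩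
  · rintro hS ⟨k, hk, hkμ, hfeas⟩
    have hn : (0 : ℝ) < Fintype.card V := by exact_mod_cast Fintype.card_pos
    have hμs : 0 < √μ := Real.sqrt_pos.2 hμ
    have hε2 : 28672 * ε ≤ 1 / 4 := by linarith
    have hε4 : (28672 * ε) ^ 4 ≤ (1 / 4) ^ 4 := pow_le_pow_left₀ (by positivity) hε2 4
    have hbound := SSE.fourNormBound_of_expansion (lam := 1 - 28672 * ε) (η := 1 / 28672) hD hG
      (by norm_num) (by positivity : 0 < 28672 * √μ) (by
        rw [sub_sub_cancel]
        linarith) hS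
    have h := SSE.pow_five_le_of_feasible (by norm_num) hk hfeas (by positivity) hbound
    set d : ℝ := (Module.finrank ℝ (SSE.topEigenspace G (1 - 28672 * ε)) : ℝ) with hd
    have hd0 : 0 ≤ d := by positivity
    set t : ℝ := SSE.dimFactor G (1 - 28672 * ε) with ht
    have ht0 : 0 ≤ t := Real.rpow_nonneg hd0 _
    have ht3 : t ^ 3 = d := by
      rw [ht, SSE.dimFactor, ← hd, ← Real.rpow_natCast, ← Real.rpow_mul hd0]
      norm_num
    have h1 : (k : ℝ) / Fintype.card V * t ≤ μ := by
      rcases ht0.eq_or_lt with h0 | h0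
      · rw [← h0, mul_zero]
        exact hμ.le
      · exact (le_div_iff₀ h0).1 hkμ
    have h2 : 56 / (28672 * √μ * Fintype.card V) * k * t ≤ 1 / 2 ^ 9 := by
      calc 56 / (28672 * √μ * Fintype.card V) * k * t
          = 1 / 2 ^ 9 * ((k : ℝ) / Fintype.card V * t) / √μ := by
            field_simp
            ring
        _ ≤ 1 / 2 ^ 9 * μ / √μ := by gcongr
        _ = 1 / 2 ^ 9 * √μ := by rw [mul_div_assoc, Real.div_sqrt]
        _ ≤ 1 / 2 ^ 9 * 1 := by
            gcongr
            exact Real.sqrt_le_one.2 hμ₁.le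
        _ = _ := mul_one _
    have h3 : (56 / (28672 * √μ * Fintype.card V) * k) ^ 3 * d ≤ (1 / 2 ^ 9) ^ 3 := by
      rw [← ht3, ← mul_pow]
      exact pow_le_pow_left₀ (by positivity) h2 3
    have h4 := h.trans h3
    norm_num at h4
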